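/- Let $K\subseteq\mathbb R^n$ be a centrally symmetric convex body in John's position with associated decomposition of the identity $(c_j,v_j)_{j=1}^m$; that is, $B_2^n\subseteq K$ (the unit ball being the maximal volume ellipsoid of $K$), $v_j\in\partial K\cap S^{n-1}$, $c_j>0$ and $$\mathrm{Id}_n=\sum_{j=1}^m c_j\,v_j\otimes v_j .$$ Let $H\subseteq\mathbb R^n$ be a $k$-dimensional linear subspace, $P_H$ the orthogonal projection onto $H$, $J=\{j: P_Hv_j\neq0\}$, $m_0=\# J$, and for $j\in J$ put $\tilde c_j=c_j\|P_Hv_j\|_2^2$ and $t_j=\|P_Hv_j\|_2^{-1}$. Let $L=\{x\in\mathbb R^n: |\langle x,v_j\rangle|\le 1\ \text{for all } j\}$ and $C=L\cap H$. For a compact convex set $M\subseteq H$ let $$\mathcal W(M)=\int_H e^{-\pi d^2(x,M)}\,dx$$ be the Wills functional (equivalently, the sum of the intrinsic volumes of $M$). Let $\lambda>0$ and put $\alpha_j=\lambda\sqrt{\tilde c_j}\,t_j$. Then $K\subseteq L$ and $$\mathcal W(\lambda(K\cap H))\le\mathcal W(\lambda C)\le\frac{1}{(2\pi)^{m_0-k}}\prod_{j\in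 J}\left(\int_{\mathbb R}h_{\lambda,j}(t)\,dt\right)^{1-\tilde c_j},$$ where, for $t\neq0$, $$h_{\lambda,j}(t)=\left|\frac{2\sin(\alpha_j\sqrt{1-\tilde c_j}\,t)}{\sqrt{1-\tilde c_j}\,t}+\cos(\alpha_j\sqrt{1-\tilde c_j}\,t)\,e^{-\frac{(1-\tilde c_j)t^2}{4\pi}}-2\sin(\alpha_j\sqrt{1-\tilde c_j}\,t)\int_0^\infty e^{-\pi y^2}\sin(y\sqrt{1-\tilde c_j}\,t)\,dy\right|^{\frac1{1-\tilde c_j}}$$ and $h_{\lambda,j}(0)=(2\alpha_j+1)^{\frac{1}{1-\tilde c_j}}$. If $\tilde c_j=1$ for some $j\in J$, the corresponding factor of the product is understood as its limiting value $2\alpha_j+1$. Moreover, for every $j\in J$ with $\tilde c_j\ne1$ the function $h_{\lambda,j}$ is integrable on $\mathbb R$, and for all $t\in\mathbb R$ $$h_{\lambda,j}(t)=\left|\widehat{f}_{\alpha_j}(\sqrt{1-\tilde c_j}\,t)\right|^{\frac1{1-\tilde c_j}},\qquad f_\alpha(x)=e^{-\pi d^2(x,[-\alpha,\alpha])},\quad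 \widehat f_\alpha(z)=\int_{\mathbb R}f_\alpha(x)e^{ixz}\,dx .$$ -/

import Mathlib

open MeasureTheory
open scoped RealInnerProductSpace Pointwise

section Wills

variable {V : Type*} [NormedAddCommGroup V] [InnerProductSpace ℝ V] [FiniteDimensional ℝ V]
  [MeasurableSpace V] [BorelSpace V]

/-- The Wills functional `𝒲(s) = ∫_V exp (-π d(x, s)²) dx` of a subset `s` of a finite-dimensional
Euclidean space `V` (`dx` is Lebesgue measure of `V`). It equals the sum of the intrinsic volumes
of `s`; see `willsFunctional_eq_sum_intrinsicVolumes`. -/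
noncomputable def willsFunctional (s : Set V) : ℝ :=
  ∫ x : V, Real.exp (-Real.pi * Metric.infDist x s ^ 2)

/-- `V₀, …, V_d` are the intrinsic volumes of `s` in the `d`-dimensional Euclidean space `V`,
through Steiner's formula `vol (s + r B) = ∑ ω_{d-i} V_i r^{d-i}` for all `r ≥ 0`, with
`ω_j = π^{j/2} / Γ(j/2 + 1)` the volume of the `j`-dimensional unit ball. -/
def IsIntrinsicVolumes (s : Set V) (I : ℕ → ℝ) : Prop :=
  ∀ r : ℝ, 0 ≤ r →
    (volume : Measure V).real (s + Metric.closedBall 0 r) =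
      ∑ i ∈ Finset.range (Module.finrank ℝ V + 1),
        Real.pi ^ (((Module.finrank ℝ V - i : ℕ) : ℝ) / 2) /
          Real.Gamma (((Module.finrank ℝ V - i : ℕ) : ℝ) / 2 + 1) *
          I i * r ^ (Module.finrank ℝ V - i)

/-- The integral defining the Wills functional of a nonempty bounded set converges. -/
theorem integrable_willsFunctional {s : Set V} (hs : s.Nonempty) (hb : Bornology.IsBounded s) :
    Integrable (fun x : V => Real.exp (-Real.pi * Metric.infDist x s ^ 2)) := by
  obtain ⟨R, hR⟩ := hb.subset_closedBall (0 : V)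
  have hR0 : 0 ≤ R := by
    obtain ⟨y, hy⟩ := hs
    have h1 := hR hy
    simp only [mem_closedBall_zero_iff] at h1
    exact (norm_nonneg y).trans h1
  have hg : Integrable (fun x : V => Real.exp (Real.pi * R ^ 2) *
      Real.exp (-(Real.pi / 2) * ‖x‖ ^ 2)) := by
    have h := (GaussianFourier.integrable_cexp_neg_mul_sq_norm_add (V := V)
      (b := ((Real.pi / 2 : ℝ) : ℂ)) (by simpa using by positivity) 0 0).norm
    refine Integrable.const_mul (h.congr (Filter.Eventually.of_forall fun x => ?_)) _
    simp only [Complex.norm_exp]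
    congr 1
    simp [← Complex.ofReal_pow]
  refine hg.mono' ?_ (Filter.Eventually.of_forall fun x => ?_)
  · have : Continuous fun x : V => Real.exp (-Real.pi * Metric.infDist x s ^ 2) :=
      Real.continuous_exp.comp
        (continuous_const.mul ((Metric.continuous_infDist_pt s).pow 2))
    exact this.aestronglyMeasurable
  · rw [Real.norm_eq_abs, abs_of_pos (Real.exp_pos _), ← Real.exp_add, Real.exp_le_exp]
    have h1 : ‖x‖ ≤ Metric.infDist x s + R := by
      have h2 : ‖x‖ - R ≤ Metric.infDist x s := by
        rw [Metric.le_infDist hs]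
        intro y hy
        have h3 := hR hy
        simp only [mem_closedBall_zero_iff] at h3
        have h4 := norm_sub_norm_le x y
        rw [dist_eq_norm]
        linarith
      linarith
    have h0 : 0 ≤ Metric.infDist x s := Metric.infDist_nonneg
    have h5 : ‖x‖ ^ 2 ≤ 2 * (Metric.infDist x s ^ 2 + R ^ 2) := by
      have := norm_nonneg x
      nlinarith [sq_nonneg (Metric.infDist x s - R)]
    nlinarith [Real.pi_pos]

/-- Hadwiger's formula: the Wills functional is the sum of the intrinsic volumes. -/
theorem willsFunctional_eq_sum_intrinsicVolumes {s : Set V} (hs : s.Nonempty) (hc : IsCompact s)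
    {I : ℕ → ℝ} (hI : IsIntrinsicVolumes s I) :
    willsFunctional s = ∑ i ∈ Finset.range (Module.finrank ℝ V + 1), I i := by
  have hpi := Real.pi_pos
  rw [willsFunctional, (integrable_willsFunctional hs hc.isBounded).integral_eq_integral_meas_le
    (Filter.Eventually.of_forall fun x => (Real.exp_pos _).le)]
  have himg : (fun u : ℝ => Real.exp (-u)) '' Set.univ = Set.Ioi 0 := by
    ext t
    constructor
    · rintro ⟨u, -, rfl⟩
      exact Real.exp_pos _
    · intro ht
      exact ⟨-Real.log t, trivial, by simp [Real.exp_log ht]⟩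
  rw [← himg, integral_image_eq_integral_abs_deriv_smul MeasurableSet.univ
    (f' := fun u => -Real.exp (-u)) (fun x _ => by
      simpa using HasDerivAt.hasDerivWithinAt (s := Set.univ) (hasDerivAt_neg x).exp)
    (fun x _ y _ h => by simpa using h)]
  have hval : ∀ u : ℝ, |(-Real.exp (-u))| • (volume : Measure V).real
        {a : V | Real.exp (-u) ≤ Real.exp (-Real.pi * Metric.infDist a s ^ 2)} =
      (Set.Ici (0 : ℝ)).indicator (fun u =>
        ∑ i ∈ Finset.range (Module.finrank ℝ V + 1),
          I i * (1 / Real.Gamma (((Module.finrank ℝ V - i : ℕ) : ℝ) / 2 + 1) *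
            (Real.exp (-u) * u ^ ((((Module.finrank ℝ V - i : ℕ) : ℝ) / 2 + 1) - 1)))) u := by
    intro u
    by_cases hu : 0 ≤ u
    · rw [Set.indicator_of_mem (by exact hu)]
      have hset : {a : V | Real.exp (-u) ≤ Real.exp (-Real.pi * Metric.infDist a s ^ 2)} =
          s + Metric.closedBall 0 (Real.sqrt (u / Real.pi)) := by
        rw [hc.add_closedBall_zero (Real.sqrt_nonneg _)]
        ext a
        have hne := Metric.infEDist_ne_top hs (x := a)
        rw [Set.mem_ofPred_eq, Real.exp_le_exp, Metric.mem_cthickening_iff,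
          ← ENNReal.ofReal_toReal hne, ENNReal.ofReal_le_ofReal_iff (Real.sqrt_nonneg _)]
        change _ ↔ Metric.infDist a s ≤ _
        have hup : 0 ≤ u / Real.pi := by positivity
        rw [Real.le_sqrt Metric.infDist_nonneg hup, le_div_iff₀ hpi]
        constructor <;> intro h <;> nlinarith
      rw [hset, hI _ (Real.sqrt_nonneg _), abs_neg, abs_of_pos (Real.exp_pos _), smul_eq_mul,
        Finset.mul_sum]
      refine Finset.sum_congr rfl fun i _ => ?_
      have hpow : Real.sqrt (u / Real.pi) ^ (Module.finrank ℝ V - i) =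
          u ^ (((Module.finrank ℝ V - i : ℕ) : ℝ) / 2) /
            Real.pi ^ (((Module.finrank ℝ V - i : ℕ) : ℝ) / 2) := by
        rw [← Real.div_rpow hu hpi.le, Real.sqrt_eq_rpow, ← Real.rpow_natCast,
          ← Real.rpow_mul (by positivity)]
        congr 1
        ring
      have hpp : Real.pi ^ (((Module.finrank ℝ V - i : ℕ) : ℝ) / 2) ≠ 0 :=
        (Real.rpow_pos_of_pos hpi _).ne'
      rw [hpow, add_sub_cancel_right]
      field_simp
    · rw [Set.indicator_of_notMem (by exact hu)]
      have hset : {a : V | Real.exp (-u) ≤ Real.exp (-Real.pi * Metric.infDist a s ^ 2)} = ∅ := by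
        ext a
        simp only [Set.mem_ofPred_eq, Set.mem_empty_iff_false, iff_false, not_le, Real.exp_lt_exp]
        push Not at hu
        nlinarith [sq_nonneg (Metric.infDist a s)]
      rw [hset]
      simp
  simp_rw [hval]
  rw [setIntegral_univ, integral_indicator measurableSet_Ici, integral_Ici_eq_integral_Ioi]
  have hG : ∀ i : ℕ, 0 < ((Module.finrank ℝ V - i : ℕ) : ℝ) / 2 + 1 := fun i => by positivity
  rw [integral_finsetSum _ fun i _ =>
    ((Real.GammaIntegral_convergent (hG i)).const_mul _).const_mul _]
  refine Finset.sum_congr rfl fun i _ => ?_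
  rw [integral_const_mul, integral_const_mul, ← Real.Gamma_eq_integral (hG i),
    one_div_mul_cancel (Real.Gamma_pos_of_pos (hG i)).ne', mul_one]

end Wills

/-- The function `t ↦ exp (-π d(t, [-α, α])²)` on the line. -/
noncomputable def distGaussian (α t : ℝ) : ℝ :=
  Real.exp (-Real.pi * Metric.infDist t (Set.Icc (-α) α) ^ 2)

/-- The Fourier transform `z ↦ ∫ f(x) e^{ixz} dx` of `f(x) = exp (-π d(x, [-α, α])²)`. -/
noncomputable def distGaussianHat (α z : ℝ) : ℂ :=
  ∫ x : ℝ, (distGaussian α x : ℂ) * Complex.exp (Complex.I * x * z)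

/-- The function `h`, written in terms of `d = c̃_j` and `α = λ √c̃_j t_j`. -/
noncomputable def hFun (d α t : ℝ) : ℝ :=
  if t = 0 then (2 * α + 1) ^ (1 / (1 - d))
  else
    |2 * Real.sin (α * √(1 - d) * t) / (√(1 - d) * t)
      + Real.cos (α * √(1 - d) * t) * Real.exp (-((1 - d) * t ^ 2 / (4 * Real.pi)))
      - 2 * Real.sin (α * √(1 - d) * t) *
        ∫ y in Set.Ioi (0 : ℝ), Real.exp (-Real.pi * y ^ 2) * Real.sin (y * √(1 - d) * t)|
      ^ (1 / (1 - d))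

/-- The factor `(∫ h)^{1 - d}` of the bound. For `d = 1` the exponents `1 / (1 - d)` and `1 - d`
have no meaning, and the factor is read as the limiting value `sup |f̂| = f̂(0) = 2 α + 1`. -/
noncomputable def hFactor (d α : ℝ) : ℝ :=
  if d = 1 then 2 * α + 1 else (∫ t : ℝ, hFun d α t) ^ (1 - d)

section John

variable {n m : ℕ}

/-- `(c_j, v_j)` is a decomposition of the identity associated with the body `K` in John's
position: the Euclidean unit ball lies in `K`, the `v_j` are contact points of `K` with the unit
sphere, the `c_j` are positive, and `∑ c_j v_j ⊗ v_j = Id`. -/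
structure IsJohnDecomposition (K : Set (EuclideanSpace ℝ (Fin n))) (c : Fin m → ℝ)
    (v : Fin m → EuclideanSpace ℝ (Fin n)) : Prop where
  ball_subset : Metric.closedBall 0 1 ⊆ K
  mem_frontier : ∀ j, v j ∈ frontier K
  norm_eq_one : ∀ j, ‖v j‖ = 1
  pos : ∀ j, 0 < c j
  sum_eq : ∀ x, ∑ j, c j • ⟪v j, x⟫ • v j = x

/-- The polytope `L = {x : |⟨x, v_j⟩| ≤ 1 for all j}`. -/
def contactPolytope (v : Fin m → EuclideanSpace ℝ (Fin n)) : Set (EuclideanSpace ℝ (Fin n)) :=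
  {x | ∀ j, |⟪x, v j⟫| ≤ 1}

variable (H : Submodule ℝ (EuclideanSpace ℝ (Fin n)))

/-- The section `K ∩ H`, as a subset of the Euclidean space `H`. -/
def sectionOf (K : Set (EuclideanSpace ℝ (Fin n))) : Set H := (fun x : H => (x : EuclideanSpace ℝ (Fin n))) ⁻¹' K

/-- `c̃ = c ‖P_H v‖²`. -/
noncomputable def tildeC (c : ℝ) (v : EuclideanSpace ℝ (Fin n)) : ℝ :=
  c * ‖H.starProjection v‖ ^ 2

/-- `λ √c̃ t`, where `t = ‖P_H v‖⁻¹`; here `a` stands for `λ`. -/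
noncomputable def alphaOf (a c : ℝ) (v : EuclideanSpace ℝ (Fin n)) : ℝ :=
  a * √(tildeC H c v) * ‖H.starProjection v‖⁻¹

open Classical in
/-- `J = {j : P_H v_j ≠ 0}`. -/
noncomputable def indexJ (v : Fin m → EuclideanSpace ℝ (Fin n)) : Finset (Fin m) :=
  {j | H.starProjection (v j) ≠ 0}

end John

/-! The map `x ↦ (√c_j ⟨v_j, x⟩)_{j ∈ J}` embeds `H` isometrically in `ℝ^J`
(`exists_isometry_indexJ`), because dropping the `v_j` orthogonal to `H` does not change the
decomposition of the identity on `H`. It sends `λC` into the box with half-widths `α_j = λ√c_j`. The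
distance to `λC` is therefore at least the distance to the box, whose Gaussian is a product of the
functions `f_{α_j}` (`willsFunctional_le_integral_prod_distGaussian`).

It remains to integrate a product function over the range of the embedding. Fourier inversion turns
this into an integral of `∏ f̂_{α_j}(w_j)` over the orthogonal complement, of dimension `m₀ - k`,
with the factor `(2π)^{-(m₀-k)}` (`integral_prod_comp_isometry_eq`,
`integral_prod_distGaussian_le`). There `w_j = ⟨b_j, w⟩`, with `b_j` the projection of the `j`-th
basis vector and `‖b_j‖² = 1 - c̃_j`. The nonzero `b_j`, normalised, decompose the identity with
weights `1 - c̃_j`. The geometric Brascamp–Lieb inequality applied to `h_j = |f̂_{α_j}(√(1 - c̃_j)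
·)|^{1/(1 - c̃_j)}` gives the product (`lintegral_prod_norm_distGaussianHat_le`). Its integrals are
finite because `f̂_α` decays like `1/|z|` and the exponent exceeds `1` (`integrable_hFun`).

Brascamp–Lieb is proved by transporting each density to the Gaussian. The inclusion `K ⊆ L` holds
since a supporting hyperplane of `K` at a contact point also supports the unit ball, so its normal
is the contact point itself. -/

/-! ### Monotone transport on the line. -/

section Transport

open Filter Topology

/-- The distribution function of a continuous positive probability density is differentiable,
strictly increasing, and takes exactly the values in `(0, 1)`. -/
theorem cdf_of_continuous_pos_density {h : ℝ → ℝ} (hc : Continuous h) (hpos : ∀ t, 0 < h t)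
    (hi : Integrable h) (h1 : ∫ t, h t = 1) :
    (∀ t, HasDerivAt (fun t => ∫ x in Set.Iic t, h x) (h t) t) ∧
      StrictMono (fun t => ∫ x in Set.Iic t, h x) ∧
      Set.range (fun t => ∫ x in Set.Iic t, h x) = Set.Ioo 0 1 := by
  have hd : ∀ t, HasDerivAt (fun t => ∫ x in Set.Iic t, h x) (h t) t := by
    intro t
    have h2 : (fun t => ∫ x in Set.Iic t, h x) =
        fun t => (∫ x in Set.Iic 0, h x) + ∫ x in (0 : ℝ)..t, h x := by
      ext s
      rw [← intervalIntegral.integral_Iic_sub_Iic hi.integrableOn hi.integrableOn]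
      ring
    rw [h2]
    exact (intervalIntegral.integral_hasDerivAt_right (hc.intervalIntegrable _ _)
      hc.stronglyMeasurable.stronglyMeasurableAtFilter hc.continuousAt).const_add _
  have hm : StrictMono (fun t => ∫ x in Set.Iic t, h x) := strictMono_of_hasDerivAt_pos hd hpos
  have ht : Tendsto (fun t => ∫ x in Set.Iic t, h x) atTop (𝓝 1) := by
    rw [← h1]
    exact (aecover_Iic tendsto_id).integral_tendsto_of_countably_generated hi
  have hb : Tendsto (fun t => ∫ x in Set.Iic t, h x) atBot (𝓝 0) :=
    tendsto_integral_Iic_zero tendsto_id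
  refine ⟨hd, hm, Set.Subset.antisymm ?_ ?_⟩
  · rintro _ ⟨t, rfl⟩
    exact ⟨(hm.monotone.le_of_tendsto hb (t - 1)).trans_lt (hm (by linarith)),
      (hm (show t < t + 1 by linarith)).trans_le (hm.monotone.ge_of_tendsto ht (t + 1))⟩
  · rintro y ⟨hy0, hy1⟩
    obtain ⟨a, ha⟩ := (hb.eventually_lt_const hy0).exists
    obtain ⟨b, hb⟩ := (ht.eventually_const_lt hy1).exists
    exact mem_range_of_exists_le_of_exists_ge
      (continuous_iff_continuousAt.2 fun t => (hd t).continuousAt) ⟨a, ha.le⟩ ⟨b, hb.le⟩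

/-- Monotone transport of a continuous positive probability density `h` onto another one, `g`. -/
theorem exists_monotone_transport {h g : ℝ → ℝ} (hc : Continuous h) (hpos : ∀ t, 0 < h t)
    (hi : Integrable h) (h1 : ∫ t, h t = 1) (gc : Continuous g) (gpos : ∀ t, 0 < g t)
    (gi : Integrable g) (g1 : ∫ t, g t = 1) :
    ∃ T : ℝ → ℝ, ∀ t, HasDerivAt T (h t / g (T t)) t := by
  obtain ⟨hd, hm, hr⟩ := cdf_of_continuous_pos_density hc hpos hi h1
  obtain ⟨gd, gm, gr⟩ := cdf_of_continuous_pos_density gc gpos gi g1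
  set F := fun t => ∫ x in Set.Iic t, h x
  set G := fun t => ∫ x in Set.Iic t, g x
  -- Both distribution functions have range `(0, 1)`, so `T = G⁻¹ ∘ F` is defined everywhere and is
  -- onto.
  have hex : ∀ t, ∃ s, G s = F t := fun t => by
    have : F t ∈ Set.range G := by rw [gr, ← hr]; exact ⟨t, rfl⟩
    exact this
  choose T hT using hex
  have hTm : StrictMono T := fun x y hxy => by
    rw [← gm.lt_iff_lt, hT, hT]
    exact hm hxy
  have hTs : Function.Surjective T := fun s => by
    have : G s ∈ Set.range F := by rw [hr, ← gr]; exact ⟨s, rfl⟩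
    obtain ⟨t, ht⟩ := this
    exact ⟨t, gm.injective (by rw [hT, ht])⟩
  -- Continuity is needed before differentiability: it lets the slopes of `G` be evaluated along `T
  -- x → T t`.
  have hTc : Continuous T := hTm.monotone.continuous_of_surjective hTs
  refine ⟨T, fun t => ?_⟩
  rw [hasDerivAt_iff_tendsto_slope]
  have e1 := (hasDerivAt_iff_tendsto_slope.1 (hd t))
  have e2 := (hasDerivAt_iff_tendsto_slope.1 (gd (T t)))
  have e3 : Tendsto T (𝓝[≠] t) (𝓝[≠] (T t)) :=
    tendsto_nhdsWithin_of_tendsto_nhds_of_eventually_within _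
      (hTc.continuousAt.tendsto.mono_left nhdsWithin_le_nhds)
      (eventually_nhdsWithin_of_forall fun x hx => hTm.injective.ne hx)
  -- Since `G ∘ T = F`, the slope of `T` is the slope of `F` divided by that of `G` at the
  -- transported points.
  refine (e1.div (e2.comp e3) (gpos _).ne').congr' ?_
  refine eventually_nhdsWithin_of_forall fun x hx => ?_
  have hTx : T x - T t ≠ 0 := sub_ne_zero.2 (hTm.injective.ne hx)
  have hxt : x - t ≠ 0 := sub_ne_zero.2 hx
  have hF : F x - F t ≠ 0 := sub_ne_zero.2 (hm.injective.ne hx)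
  simp only [Pi.div_apply, Function.comp_apply, slope_def_field, hT]
  field_simp

end Transport

/-! ### Geometric Brascamp–Lieb inequality by transport. -/

section BrascampLieb

variable {W : Type*} [NormedAddCommGroup W] [InnerProductSpace ℝ W]
  {ι : Type*} [Fintype ι]

/-- The operator `∑ b_j w_j ⊗ w_j`. -/
noncomputable def sumRankOne (b : ι → ℝ) (w : ι → W) : W →L[ℝ] W :=
  ∑ j, b j • (innerSL ℝ (w j)).smulRight (w j)

theorem sumRankOne_apply (b : ι → ℝ) (w : ι → W) (x : W) :
    sumRankOne b w x = ∑ j, b j • ⟪w j, x⟫ • w j := by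
  simp [sumRankOne]

theorem inner_sumRankOne (b : ι → ℝ) (w : ι → W) (x y : W) :
    ⟪sumRankOne b w x, y⟫ = ∑ j, b j * (⟪w j, x⟫ * ⟪w j, y⟫) := by
  simp [sumRankOne_apply, sum_inner, inner_smul_left]

/-- A decomposition of the identity gives Parseval's identity. -/
theorem sum_mul_inner_of_decomposition {p : ι → ℝ} {w : ι → W}
    (hid : ∀ x, ∑ j, p j • ⟪w j, x⟫ • w j = x) (x y : W) :
    ∑ j, p j * (⟪w j, x⟫ * ⟪w j, y⟫) = ⟪x, y⟫ := by
  rw [← inner_sumRankOne, sumRankOne_apply, hid]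

/-- The adjoint of the isometry `x ↦ (√p_j ⟨w_j, x⟩)_j` is a contraction. -/
theorem norm_sq_sum_smul_le {p s : ι → ℝ} {w : ι → W} (hp : ∀ j, 0 < p j)
    (hid : ∀ x, ∑ j, p j • ⟪w j, x⟫ • w j = x) :
    ‖∑ j, (p j * s j) • w j‖ ^ 2 ≤ ∑ j, p j * s j ^ 2 := by
  set y := ∑ j, (p j * s j) • w j
  have h1 : ‖y‖ ^ 2 = ∑ j, p j * (s j * ⟪w j, y⟫) := by
    rw [← real_inner_self_eq_norm_sq]
    conv_lhs => enter [2]; rw [show y = ∑ j, (p j * s j) • w j from rfl]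
    rw [sum_inner]
    exact Finset.sum_congr rfl fun j _ => by rw [inner_smul_left]; simp; ring
  have h2 := sum_mul_inner_of_decomposition hid y y
  rw [real_inner_self_eq_norm_sq] at h2
  -- Expanded, this is `∑ p_j s_j² - 2‖y‖² + ‖y‖²`, the last term by Parseval.
  have h3 : 0 ≤ ∑ j, p j * (s j - ⟪w j, y⟫) ^ 2 :=
    Finset.sum_nonneg fun j _ => mul_nonneg (hp j).le (sq_nonneg _)
  have h4 : ∑ j, p j * (s j - ⟪w j, y⟫) ^ 2 = ∑ j, p j * s j ^ 2 -
      2 * ∑ j, p j * (s j * ⟪w j, y⟫) + ∑ j, p j * (⟪w j, y⟫ * ⟪w j, y⟫) := by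
    rw [Finset.mul_sum, ← Finset.sum_sub_distrib, ← Finset.sum_add_distrib]
    exact Finset.sum_congr rfl fun j _ => by ring
  rw [h4, ← h1, h2] at h3
  linarith

variable [FiniteDimensional ℝ W]

/-- Ball's determinant inequality. -/
theorem prod_rpow_le_det_sumRankOne {p b : ι → ℝ} {w : ι → W} (hp : ∀ j, 0 < p j)
    (hw : ∀ j, ‖w j‖ = 1) (hid : ∀ x, ∑ j, p j • ⟪w j, x⟫ • w j = x) (hb : ∀ j, 0 < b j) :
    ∏ j, b j ^ p j ≤ (sumRankOne (fun j => p j * b j) w).det := by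
  classical
  have hS : (sumRankOne (fun j => p j * b j) w : W →ₗ[ℝ] W).IsSymmetric := by
    intro x y
    change ⟪sumRankOne _ w x, y⟫ = ⟪x, sumRankOne _ w y⟫
    rw [real_inner_comm _ x, inner_sumRankOne, inner_sumRankOne]
    exact Finset.sum_congr rfl fun j _ => by ring
  have hdet : (sumRankOne (fun j => p j * b j) w).det =
      ∏ i, hS.eigenvalues rfl i := by
    have := hS.det_eq_prod_eigenvalues rfl
    simpa using this
  set e := hS.eigenvectorBasis rfl
  -- Each eigenvalue is a weighted mean of the `b_j`, with total weight `1` by Parseval, so AM–GM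
  -- applies to it. In the product over `i` the exponent of `b_j` adds up to `p_j ‖w_j‖² = p_j`.
  have hev : ∀ i, hS.eigenvalues rfl i = ∑ j, (p j * ⟪w j, e i⟫ ^ 2) * b j := by
    intro i
    have h1 := hS.apply_eigenvectorBasis rfl i
    have h2 : ⟪sumRankOne (fun j => p j * b j) w (e i), e i⟫ = hS.eigenvalues rfl i := by
      change ⟪(sumRankOne (fun j => p j * b j) w : W →ₗ[ℝ] W) (e i), e i⟫ = _
      rw [h1, inner_smul_left]
      simp [e]
    rw [← h2, inner_sumRankOne]
    exact Finset.sum_congr rfl fun j _ => by ring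
  have hsum : ∀ i, ∑ j, p j * ⟪w j, e i⟫ ^ 2 = 1 := by
    intro i
    have := sum_mul_inner_of_decomposition hid (e i) (e i)
    rw [real_inner_self_eq_norm_sq, e.norm_eq_one] at this
    simpa [sq] using this
  rw [hdet]
  calc ∏ j, b j ^ p j = ∏ i, ∏ j, b j ^ (p j * ⟪w j, e i⟫ ^ 2) := by
        rw [Finset.prod_comm]
        refine Finset.prod_congr rfl fun j _ => ?_
        rw [← Real.rpow_sum_of_pos (hb j), ← Finset.mul_sum]
        congr 1
        have := e.sum_sq_inner_right (w j)
        simp_rw [real_inner_comm (w j)] at this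
        rw [this, hw j]
        ring
    _ ≤ ∏ i, hS.eigenvalues rfl i := by
        refine Finset.prod_le_prod (fun i _ => Finset.prod_nonneg fun j _ =>
          Real.rpow_nonneg (hb j).le _) fun i _ => ?_
        rw [hev i]
        exact Real.geom_mean_le_arith_mean_weighted _ _ _
          (fun j _ => mul_nonneg (hp j).le (sq_nonneg _)) (hsum i) fun j _ => (hb j).le

variable [MeasurableSpace W] [BorelSpace W]

theorem integrable_exp_neg_mul_norm_sq {b : ℝ} (hb : 0 < b) :
    Integrable fun x : W => Real.exp (-b * ‖x‖ ^ 2) := by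
  -- A non-integrable function has integral `0` by convention, against the positive Gaussian value.
  by_contra hn
  have h1 := GaussianFourier.integral_rexp_neg_mul_sq_norm (V := W) hb
  rw [integral_undef hn] at h1
  have : 0 < (Real.pi / b) ^ ((Module.finrank ℝ W : ℝ) / 2) :=
    Real.rpow_pos_of_pos (div_pos Real.pi_pos hb) _
  linarith

theorem lintegral_gaussian_norm_sq :
    ∫⁻ x : W, ENNReal.ofReal (Real.exp (-Real.pi * ‖x‖ ^ 2)) = 1 := by
  have hi := integrable_exp_neg_mul_norm_sq (W := W) Real.pi_pos
  rw [← ofReal_integral_eq_lintegral_ofReal hi (ae_of_all _ fun x => (Real.exp_pos _).le),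
    GaussianFourier.integral_rexp_neg_mul_sq_norm Real.pi_pos]
  simp

theorem integrable_exp_neg_pi_sq : Integrable fun t : ℝ => Real.exp (-Real.pi * t ^ 2) :=
  integrable_exp_neg_mul_sq Real.pi_pos

theorem integral_exp_neg_pi_sq : ∫ t : ℝ, Real.exp (-Real.pi * t ^ 2) = 1 := by
  rw [integral_gaussian, div_self Real.pi_ne_zero, Real.sqrt_one]

/-- The geometric Brascamp–Lieb inequality for positive continuous probability densities. -/
theorem geometric_brascampLieb_of_density {p : ι → ℝ} {w : ι → W} (hp : ∀ j, 0 < p j)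
    (hw : ∀ j, ‖w j‖ = 1) (hid : ∀ x, ∑ j, p j • ⟪w j, x⟫ • w j = x)
    {h : ι → ℝ → ℝ} (hc : ∀ j, Continuous (h j)) (hpos : ∀ j t, 0 < h j t)
    (hi : ∀ j, Integrable (h j)) (h1 : ∀ j, ∫ t, h j t = 1) :
    ∫⁻ x, ENNReal.ofReal (∏ j, h j ⟪w j, x⟫ ^ p j) ≤ 1 := by
  have hT := fun j => exists_monotone_transport (hc j) (hpos j) (hi j) (h1 j)
    (g := fun t => Real.exp (-Real.pi * t ^ 2)) (by fun_prop) (fun t => Real.exp_pos _)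
    integrable_exp_neg_pi_sq integral_exp_neg_pi_sq
  choose T hT using hT
  set T' : ι → ℝ → ℝ := fun j t => h j t / Real.exp (-Real.pi * T j t ^ 2)
  have hT'pos : ∀ j t, 0 < T' j t := fun j t => div_pos (hpos j t) (Real.exp_pos _)
  have hTm : ∀ j, StrictMono (T j) := fun j => strictMono_of_hasDerivAt_pos (hT j) (hT'pos j)
  -- The one-dimensional transports are glued into a map of `W` whose Jacobian is bounded below by
  -- Ball's inequality and whose norm is bounded above by `norm_sq_sum_smul_le`.
  let Θ : W → W := fun x => ∑ j, (p j * T j ⟪w j, x⟫) • w j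
  let Θ' : W → W →L[ℝ] W := fun x => sumRankOne (fun j => p j * T' j ⟪w j, x⟫) w
  have hΘ : ∀ x, HasFDerivAt Θ (Θ' x) x := by
    intro x
    have key : ∀ j ∈ Finset.univ, HasFDerivAt (fun x => (p j * T j ⟪w j, x⟫) • w j)
        ((p j * T' j ⟪w j, x⟫) • (innerSL ℝ (w j)).smulRight (w j)) x := by
      intro j _
      have h2 : HasFDerivAt (fun x => ⟪w j, x⟫) (innerSL ℝ (w j)) x :=
        (innerSL ℝ (w j)).hasFDerivAt
      have h3 := (((hT j ⟪w j, x⟫).comp_hasFDerivAt x h2).const_mul (p j)).smul_const (w j)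
      convert! h3 using 1
      ext y
      simp [T', mul_smul]
    exact HasFDerivAt.fun_sum key
  -- `⟨Θ x - Θ y, x - y⟩` is a sum of nonnegative terms. If it vanishes, strict monotonicity forces
  -- every `⟨w_j, x - y⟩` to be zero, hence `x = y`.
  have hinj : Function.Injective Θ := by
    intro x y hxy
    have h2 : ∑ j, p j * ((T j ⟪w j, x⟫ - T j ⟪w j, y⟫) * ⟪w j, x - y⟫) = 0 := by
      have h3 : ⟪Θ x - Θ y, x - y⟫ = 0 := by rw [hxy, sub_self, inner_zero_left]
      rw [← h3]
      simp only [Θ]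
      rw [← Finset.sum_sub_distrib, sum_inner]
      refine Finset.sum_congr rfl fun j _ => ?_
      rw [← sub_smul, inner_smul_left]
      simp
      ring
    have h4 : ∀ j, 0 ≤ p j * ((T j ⟪w j, x⟫ - T j ⟪w j, y⟫) * ⟪w j, x - y⟫) := by
      intro j
      refine mul_nonneg (hp j).le ?_
      rw [inner_sub_right]
      rcases le_total ⟪w j, x⟫ ⟪w j, y⟫ with h5 | h5
      · exact mul_nonneg_of_nonpos_of_nonpos (sub_nonpos.2 ((hTm j).monotone h5))
          (sub_nonpos.2 h5)
      · exact mul_nonneg (sub_nonneg.2 ((hTm j).monotone h5)) (sub_nonneg.2 h5)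
    rw [Finset.sum_eq_zero_iff_of_nonneg fun j _ => h4 j] at h2
    have h6 : ∀ j, ⟪w j, x - y⟫ = 0 := by
      intro j
      rcases mul_eq_zero.1 (h2 j (Finset.mem_univ j)) with h7 | h7
      · exact absurd h7 (hp j).ne'
      · rcases mul_eq_zero.1 h7 with h8 | h8
        · rw [inner_sub_right, (hTm j).injective (sub_eq_zero.1 h8), sub_self]
        · exact h8
    have h9 := hid (x - y)
    simp only [h6, zero_smul, smul_zero, Finset.sum_const_zero] at h9
    exact sub_eq_zero.1 h9.symm
  have hle : ∀ x, ENNReal.ofReal (∏ j, h j ⟪w j, x⟫ ^ p j) ≤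
      ENNReal.ofReal |(Θ' x).det| * ENNReal.ofReal (Real.exp (-Real.pi * ‖Θ x‖ ^ 2)) := by
    intro x
    rw [← ENNReal.ofReal_mul (abs_nonneg _)]
    refine ENNReal.ofReal_le_ofReal ?_
    -- The transport equation `h_j = T_j' exp(-π T_j²)`, raised to the power `p_j` and multiplied
    -- over `j`.
    have e1 : ∏ j, h j ⟪w j, x⟫ ^ p j = (∏ j, T' j ⟪w j, x⟫ ^ p j) *
        Real.exp (-Real.pi * ∑ j, p j * T j ⟪w j, x⟫ ^ 2) := by
      rw [Finset.mul_sum, Real.exp_sum, ← Finset.prod_mul_distrib]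
      refine Finset.prod_congr rfl fun j _ => ?_
      have e2 : h j ⟪w j, x⟫ = T' j ⟪w j, x⟫ * Real.exp (-Real.pi * T j ⟪w j, x⟫ ^ 2) :=
        (div_mul_cancel₀ _ (Real.exp_pos _).ne').symm
      rw [e2, Real.mul_rpow (hT'pos _ _).le (Real.exp_pos _).le, ← Real.exp_mul]
      congr 2
      ring
    rw [e1]
    refine mul_le_mul ((prod_rpow_le_det_sumRankOne hp hw hid fun j => hT'pos j _).trans
      (le_abs_self _)) ?_ (Real.exp_pos _).le (abs_nonneg _)
    rw [Real.exp_le_exp]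
    have e3 := norm_sq_sum_smul_le (s := fun j => T j ⟪w j, x⟫) hp hid
    have : ‖Θ x‖ ^ 2 ≤ ∑ j, p j * T j ⟪w j, x⟫ ^ 2 := e3
    nlinarith [Real.pi_pos]
  calc ∫⁻ x, ENNReal.ofReal (∏ j, h j ⟪w j, x⟫ ^ p j)
      ≤ ∫⁻ x, ENNReal.ofReal |(Θ' x).det| *
          ENNReal.ofReal (Real.exp (-Real.pi * ‖Θ x‖ ^ 2)) := lintegral_mono hle
    -- Only injectivity of `Θ` is used; enlarging its image to `W` goes in the right direction.
    _ = ∫⁻ y in Θ '' Set.univ, ENNReal.ofReal (Real.exp (-Real.pi * ‖y‖ ^ 2)) := by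
        rw [lintegral_image_eq_lintegral_abs_det_fderiv_mul volume MeasurableSet.univ
          (fun x _ => (hΘ x).hasFDerivWithinAt) hinj.injOn, setLIntegral_univ]
    _ ≤ ∫⁻ y, ENNReal.ofReal (Real.exp (-Real.pi * ‖y‖ ^ 2)) :=
        lintegral_mono' Measure.restrict_le_self le_rfl
    _ = 1 := lintegral_gaussian_norm_sq

open Filter Topology in
/-- The geometric Brascamp–Lieb inequality of Ball. -/
theorem geometric_brascampLieb {p : ι → ℝ} {w : ι → W} (hp : ∀ j, 0 < p j)
    (hw : ∀ j, ‖w j‖ = 1) (hid : ∀ x, ∑ j, p j • ⟪w j, x⟫ • w j = x)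
    {h : ι → ℝ → ℝ} (hc : ∀ j, Continuous (h j)) (hnn : ∀ j t, 0 ≤ h j t)
    (hi : ∀ j, Integrable (h j)) :
    ∫⁻ x, ENNReal.ofReal (∏ j, h j ⟪w j, x⟫ ^ p j) ≤
      ENNReal.ofReal (∏ j, (∫ t, h j t) ^ p j) := by
  have hI : ∀ j, 0 ≤ ∫ t, h j t := fun j => integral_nonneg (hnn j)
  have key : ∀ ε : ℝ, 0 < ε → ∫⁻ x, ENNReal.ofReal (∏ j, h j ⟪w j, x⟫ ^ p j) ≤
      ENNReal.ofReal (∏ j, ((∫ t, h j t) + ε) ^ p j) := by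
    intro ε hε
    have hpos : ∀ j, 0 < (∫ t, h j t) + ε := fun j => by linarith [hI j]
    -- Adding `ε` times a Gaussian of mass `1` makes the function strictly positive, even if `h_j`
    -- vanishes identically; dividing by the new mass gives a density. Then `ε → 0`.
    set g : ι → ℝ → ℝ := fun j t =>
      ((∫ t, h j t) + ε)⁻¹ * (h j t + ε * Real.exp (-Real.pi * t ^ 2))
    have hgi : ∀ j, Integrable fun t => h j t + ε * Real.exp (-Real.pi * t ^ 2) := fun j =>
      (hi j).add (integrable_exp_neg_pi_sq.const_mul _)
    have hgpos : ∀ j t, 0 < h j t + ε * Real.exp (-Real.pi * t ^ 2) := fun j t =>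
      add_pos_of_nonneg_of_pos (hnn j t) (mul_pos hε (Real.exp_pos _))
    have hbl := geometric_brascampLieb_of_density (h := g) hp hw hid
      (fun j => by have := hc j; fun_prop)
      (fun j t => mul_pos (inv_pos.2 (hpos j)) (hgpos j t))
      (fun j => (hgi j).const_mul _)
      (fun j => by
        rw [integral_const_mul, integral_add (hi j) (integrable_exp_neg_pi_sq.const_mul _),
          integral_const_mul, integral_exp_neg_pi_sq, mul_one, inv_mul_cancel₀ (hpos j).ne'])
    calc ∫⁻ x, ENNReal.ofReal (∏ j, h j ⟪w j, x⟫ ^ p j)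
        ≤ ∫⁻ x, ENNReal.ofReal (∏ j, ((∫ t, h j t) + ε) ^ p j) *
            ENNReal.ofReal (∏ j, g j ⟪w j, x⟫ ^ p j) := by
          refine lintegral_mono fun x => ?_
          rw [← ENNReal.ofReal_mul (Finset.prod_nonneg fun j _ =>
            Real.rpow_nonneg (hpos j).le _), ← Finset.prod_mul_distrib]
          refine ENNReal.ofReal_le_ofReal (Finset.prod_le_prod (fun j _ =>
            Real.rpow_nonneg (hnn j _) _) fun j _ => ?_)
          rw [← Real.mul_rpow (hpos j).le (mul_pos (inv_pos.2 (hpos j)) (hgpos j _)).le]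
          refine Real.rpow_le_rpow (hnn j _) ?_ (hp j).le
          rw [mul_inv_cancel_left₀ (hpos j).ne']
          linarith [mul_pos hε (Real.exp_pos (-Real.pi * ⟪w j, x⟫ ^ 2))]
      _ ≤ ENNReal.ofReal (∏ j, ((∫ t, h j t) + ε) ^ p j) * 1 := by
          rw [lintegral_const_mul' _ _ ENNReal.ofReal_ne_top]
          gcongr
      _ = _ := mul_one _
  have hlim : Tendsto (fun ε : ℝ => ENNReal.ofReal (∏ j, ((∫ t, h j t) + ε) ^ p j)) (𝓝[>] 0)
      (𝓝 (ENNReal.ofReal (∏ j, (∫ t, h j t) ^ p j))) := by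
    have hcont : Continuous fun ε : ℝ => ∏ j, ((∫ t, h j t) + ε) ^ p j :=
      continuous_finsetProd _ fun j _ =>
        (continuous_const.add continuous_id).rpow_const fun _ => Or.inr (hp j).le
    exact ((ENNReal.continuous_ofReal.comp hcont).tendsto' 0 _ (by simp)).mono_left
      nhdsWithin_le_nhds
  exact ge_of_tendsto hlim (eventually_nhdsWithin_of_forall fun ε hε => key ε hε)

end BrascampLieb

/-! ### The functions `f_α`, their transforms and the integrability of `h`. -/

section DistGaussian

open Filter Topology

theorem infDist_Icc_neg_self {α : ℝ} (hα : 0 ≤ α) (x : ℝ) :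
    Metric.infDist x (Set.Icc (-α) α) = max (|x| - α) 0 := by
  apply le_antisymm
  · rcases le_total |x| α with h | h
    · rw [Metric.infDist_zero_of_mem (show x ∈ Set.Icc (-α) α from abs_le.1 h)]
      exact le_max_right _ _
    · refine le_max_of_le_left ?_
      rcases le_total 0 x with hx | hx
      · rw [abs_of_nonneg hx] at h ⊢
        refine (Metric.infDist_le_dist_of_mem (show α ∈ Set.Icc (-α) α by
          constructor <;> linarith)).trans ?_
        rw [Real.dist_eq, abs_of_nonneg (by linarith)]
      · rw [abs_of_nonpos hx] at h ⊢
        refine (Metric.infDist_le_dist_of_mem (show -α ∈ Set.Icc (-α) α by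
          constructor <;> linarith)).trans ?_
        rw [Real.dist_eq, abs_of_nonpos (by linarith)]
        linarith
  · refine max_le ?_ Metric.infDist_nonneg
    rw [Metric.le_infDist ⟨0, by constructor <;> linarith⟩]
    intro y hy
    rw [Real.dist_eq]
    have := abs_le.2 hy
    linarith [abs_sub_abs_le_abs_sub x y]

theorem distGaussian_eq {α : ℝ} (hα : 0 ≤ α) (x : ℝ) :
    distGaussian α x = Real.exp (-Real.pi * (max (|x| - α) 0) ^ 2) := by
  rw [distGaussian, infDist_Icc_neg_self hα]

theorem distGaussian_neg {α : ℝ} (hα : 0 ≤ α) (x : ℝ) :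
    distGaussian α (-x) = distGaussian α x := by
  rw [distGaussian_eq hα, distGaussian_eq hα, abs_neg]

theorem distGaussian_pos (α x : ℝ) : 0 < distGaussian α x := Real.exp_pos _

theorem continuous_distGaussian (α : ℝ) : Continuous (distGaussian α) :=
  Real.continuous_exp.comp
    (continuous_const.mul ((Metric.continuous_infDist_pt _).pow 2))

theorem integrable_distGaussian {α : ℝ} (hα : 0 ≤ α) : Integrable (distGaussian α) :=
  integrable_willsFunctional ⟨0, by constructor <;> linarith⟩ (Metric.isBounded_Icc _ _)

theorem integrable_distGaussian_mul_cexp {α : ℝ} (hα : 0 ≤ α) (z : ℝ) :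
    Integrable fun x : ℝ => (distGaussian α x : ℂ) * Complex.exp (Complex.I * x * z) := by
  refine (integrable_distGaussian hα).mono' ?_ (ae_of_all _ fun x => ?_)
  · have := continuous_distGaussian α
    exact Continuous.aestronglyMeasurable (by fun_prop)
  · rw [norm_mul, Complex.norm_exp, Complex.norm_real, Real.norm_eq_abs,
      abs_of_pos (distGaussian_pos _ _)]
    simp

/-- Evenness of `f_α`: averaging the integral with its reflection turns the exponential into a
cosine, so the transform is real. -/
theorem distGaussianHat_eq_integral_cos {α : ℝ} (hα : 0 ≤ α) (z : ℝ) :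
    distGaussianHat α z = ((∫ x : ℝ, distGaussian α x * Real.cos (x * z) : ℝ) : ℂ) := by
  have h1 := integrable_distGaussian_mul_cexp hα z
  have h2 : distGaussianHat α z = ∫ x : ℝ, (distGaussian α (-x) : ℂ) *
      Complex.exp (Complex.I * ((-x : ℝ) : ℂ) * z) :=
    (integral_neg_eq_self (fun x : ℝ => (distGaussian α x : ℂ) *
      Complex.exp (Complex.I * x * z)) volume).symm
  have h3 : (2 : ℂ) * distGaussianHat α z =
      2 * ((∫ x : ℝ, distGaussian α x * Real.cos (x * z) : ℝ) : ℂ) := by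
    rw [two_mul]
    nth_rewrite 2 [h2]
    rw [distGaussianHat, ← integral_add h1 h1.comp_neg, ← integral_complex_ofReal,
      ← integral_const_mul]
    congr 1
    ext x
    rw [distGaussian_neg hα]
    push_cast
    rw [Complex.cos]
    have e1 : Complex.I * x * z = x * z * Complex.I := by ring
    have e2 : Complex.I * -x * z = -(x * z) * Complex.I := by ring
    rw [e1, e2]
    ring
  exact mul_left_cancel₀ two_ne_zero h3

theorem setIntegral_Ioi_comp_sub (f : ℝ → ℝ) (a : ℝ) :
    ∫ x in Set.Ioi a, f (x - a) = ∫ x in Set.Ioi 0, f x := by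
  have := (measurePreserving_sub_right volume a).setIntegral_preimage_emb
    (MeasurableEquiv.subRight a).measurableEmbedding f (Set.Ioi 0)
  simpa using this

theorem integrable_exp_neg_pi_sq_mul {b : ℝ → ℝ} (hb : Continuous b) (hb1 : ∀ x, |b x| ≤ 1) :
    Integrable fun x : ℝ => Real.exp (-Real.pi * x ^ 2) * b x := by
  refine integrable_exp_neg_pi_sq.mono' (Continuous.aestronglyMeasurable (by fun_prop))
    (ae_of_all _ fun x => ?_)
  rw [norm_mul, Real.norm_eq_abs, Real.norm_eq_abs, abs_of_pos (Real.exp_pos _)]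
  exact mul_le_of_le_one_right (Real.exp_pos _).le (hb1 x)

theorem integral_Ioi_gaussian_mul_cos (z : ℝ) :
    ∫ y in Set.Ioi (0 : ℝ), Real.exp (-Real.pi * y ^ 2) * Real.cos (y * z) =
      Real.exp (-(z ^ 2 / (4 * Real.pi))) / 2 := by
  have h1 : ∫ y : ℝ, Real.exp (-Real.pi * y ^ 2) * Real.cos (y * z) =
      2 * ∫ y in Set.Ioi (0 : ℝ), Real.exp (-Real.pi * y ^ 2) * Real.cos (y * z) := by
    rw [← integral_comp_abs]
    congr 1
    ext y
    rw [sq_abs]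
    rcases abs_cases y with ⟨h, -⟩ | ⟨h, -⟩ <;> rw [h]
    rw [neg_mul y, Real.cos_neg]
  have hb : 0 < (Real.pi : ℂ).re := by simpa using Real.pi_pos
  have h2 := fourierIntegral_gaussian hb z
  have h3 : Integrable fun x : ℝ => Complex.exp (Complex.I * z * x) *
      Complex.exp (-Real.pi * x ^ 2) := by
    refine integrable_exp_neg_pi_sq.mono' (Continuous.aestronglyMeasurable (by fun_prop))
      (ae_of_all _ fun x => ?_)
    rw [norm_mul, Complex.norm_exp, Complex.norm_exp]
    simp [← Complex.ofReal_pow]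
  have h4 := congrArg Complex.re h2
  have h5 := integral_re h3
  simp only [RCLike.re_to_complex] at h5
  rw [← h5] at h4
  have h6 : ∀ x : ℝ, (Complex.exp (Complex.I * z * x) * Complex.exp (-Real.pi * x ^ 2)).re =
      Real.exp (-Real.pi * x ^ 2) * Real.cos (x * z) := by
    intro x
    have e1 : Complex.exp (-Real.pi * x ^ 2) = ((Real.exp (-Real.pi * x ^ 2) : ℝ) : ℂ) := by
      push_cast
      ring_nf
    rw [e1, mul_comm, Complex.re_ofReal_mul, Complex.exp_re]
    simp [mul_comm]
  simp_rw [h6] at h4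
  rw [h1, div_self (by simp), Complex.one_cpow, one_mul] at h4
  have e2 : Complex.exp (-(z : ℂ) ^ 2 / (4 * Real.pi)) =
      ((Real.exp (-(z ^ 2 / (4 * Real.pi))) : ℝ) : ℂ) := by
    push_cast
    ring_nf
  rw [e2, Complex.ofReal_re] at h4
  linarith

/-- The explicit transform of `distGaussian α`, with the contribution of `[-α, α]` as an integral. -/
theorem distGaussianHat_eq_intervalIntegral {α : ℝ} (hα : 0 ≤ α) (z : ℝ) :
    distGaussianHat α z = ((2 * (∫ x in (0 : ℝ)..α, Real.cos (x * z))
      + Real.cos (α * z) * Real.exp (-(z ^ 2 / (4 * Real.pi)))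
      - 2 * Real.sin (α * z) *
        ∫ y in Set.Ioi (0 : ℝ), Real.exp (-Real.pi * y ^ 2) * Real.sin (y * z) : ℝ) : ℂ) := by
  rw [distGaussianHat_eq_integral_cos hα]
  congr 1
  -- By evenness only the half-line matters. It is cut at `α`: on `[0, α]` the Gaussian factor is
  -- `1`, and beyond it a shift and the addition formula for the cosine produce the other two terms.
  set g : ℝ → ℝ := fun x => Real.exp (-Real.pi * (max (x - α) 0) ^ 2) * Real.cos (x * z)
  have h1 : ∫ x : ℝ, distGaussian α x * Real.cos (x * z) = 2 * ∫ x in Set.Ioi 0, g x := by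
    rw [← integral_comp_abs]
    congr 1
    ext x
    simp only [g]
    rw [distGaussian_eq hα]
    rcases abs_cases x with ⟨h, -⟩ | ⟨h, -⟩ <;> rw [h]
    rw [neg_mul x, Real.cos_neg]
  have hgi : IntegrableOn g (Set.Ioi 0) := by
    have h2 : Integrable fun x => distGaussian α x * Real.cos (x * z) := by
      refine (integrable_distGaussian hα).mul_bdd (c := 1)
        (Continuous.aestronglyMeasurable (by fun_prop)) (ae_of_all _ fun x => ?_)
      exact Real.abs_cos_le_one _
    refine h2.integrableOn.congr_fun (fun x hx => ?_) measurableSet_Ioi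
    simp only [g]
    rw [distGaussian_eq hα, abs_of_pos hx]
  have h3 := intervalIntegral.integral_Ioi_sub_Ioi hgi hα
  have h4 : ∫ x in (0 : ℝ)..α, g x = ∫ x in (0 : ℝ)..α, Real.cos (x * z) := by
    refine intervalIntegral.integral_congr fun x hx => ?_
    rw [Set.uIcc_of_le hα] at hx
    simp only [g]
    rw [max_eq_right (by linarith [hx.2])]
    simp
  have h5 : ∫ x in Set.Ioi α, g x = ∫ y in Set.Ioi (0 : ℝ),
      Real.exp (-Real.pi * y ^ 2) * Real.cos ((y + α) * z) := by
    rw [← setIntegral_Ioi_comp_sub (fun y => Real.exp (-Real.pi * y ^ 2) *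
      Real.cos ((y + α) * z)) α]
    refine setIntegral_congr_fun measurableSet_Ioi fun x hx => ?_
    simp only [g]
    rw [max_eq_left (by linarith [Set.mem_Ioi.1 hx]), sub_add_cancel]
  have h6 : ∫ y in Set.Ioi (0 : ℝ), Real.exp (-Real.pi * y ^ 2) * Real.cos ((y + α) * z) =
      Real.cos (α * z) * (Real.exp (-(z ^ 2 / (4 * Real.pi))) / 2) - Real.sin (α * z) *
        ∫ y in Set.Ioi (0 : ℝ), Real.exp (-Real.pi * y ^ 2) * Real.sin (y * z) := by
    rw [← integral_Ioi_gaussian_mul_cos, ← integral_const_mul, ← integral_const_mul,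
      ← integral_sub]
    · congr 1
      ext y
      rw [add_mul, Real.cos_add]
      ring
    · exact ((integrable_exp_neg_pi_sq_mul (by fun_prop)
        fun x => Real.abs_cos_le_one _).const_mul _).integrableOn
    · exact ((integrable_exp_neg_pi_sq_mul (by fun_prop)
        fun x => Real.abs_sin_le_one _).const_mul _).integrableOn
  rw [h1]
  rw [h4, h5, h6] at h3
  linarith

theorem distGaussianHat_zero {α : ℝ} (hα : 0 ≤ α) : distGaussianHat α 0 = (2 * α + 1 : ℝ) := by
  have h := distGaussianHat_eq_intervalIntegral hα 0
  simpa using h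

theorem distGaussianHat_eq {α z : ℝ} (hα : 0 ≤ α) (hz : z ≠ 0) :
    distGaussianHat α z = ((2 * Real.sin (α * z) / z
      + Real.cos (α * z) * Real.exp (-(z ^ 2 / (4 * Real.pi)))
      - 2 * Real.sin (α * z) *
        ∫ y in Set.Ioi (0 : ℝ), Real.exp (-Real.pi * y ^ 2) * Real.sin (y * z) : ℝ) : ℂ) := by
  rw [distGaussianHat_eq_intervalIntegral hα, intervalIntegral.integral_comp_mul_right _ hz,
    integral_cos, smul_eq_mul]
  congr 3
  simp
  ring

theorem norm_distGaussianHat_neg {α : ℝ} (hα : 0 ≤ α) (z : ℝ) :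
    ‖distGaussianHat α (-z)‖ = ‖distGaussianHat α z‖ := by
  rw [distGaussianHat_eq_integral_cos hα, distGaussianHat_eq_integral_cos hα]
  simp only [mul_neg, Real.cos_neg]

theorem continuous_distGaussianHat {α : ℝ} (hα : 0 ≤ α) : Continuous (distGaussianHat α) := by
  refine continuous_of_dominated (fun z =>
    (integrable_distGaussian_mul_cexp hα z).aestronglyMeasurable)
    (fun z => ae_of_all _ fun x => ?_) (integrable_distGaussian hα)
    (ae_of_all _ fun x => by fun_prop)
  rw [norm_mul, Complex.norm_exp, Complex.norm_real, Real.norm_eq_abs,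
    abs_of_pos (distGaussian_pos _ _)]
  simp

theorem norm_distGaussianHat_le {α : ℝ} (hα : 0 ≤ α) (z : ℝ) :
    ‖distGaussianHat α z‖ ≤ 2 * α + 1 := by
  have h0 : ∫ x, distGaussian α x = 2 * α + 1 := by
    have h1 := distGaussianHat_eq_integral_cos hα 0
    rw [distGaussianHat_zero hα, Complex.ofReal_inj] at h1
    simpa using h1.symm
  rw [← h0]
  refine (norm_integral_le_integral_norm _).trans_eq ?_
  congr 1
  ext x
  rw [norm_mul, Complex.norm_exp, Complex.norm_real, Real.norm_eq_abs,
    abs_of_pos (distGaussian_pos _ _)]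
  simp

/-- Integration by parts: the boundary term is `1`, and the remaining cosine integral is at most `∫
2πy exp(-πy²) dy = 1` in absolute value. -/
theorem abs_mul_integral_gaussian_mul_sin_le (z : ℝ) :
    |z * ∫ y in Set.Ioi (0 : ℝ), Real.exp (-Real.pi * y ^ 2) * Real.sin (y * z)| ≤ 2 := by
  have hpi := Real.pi_pos
  have hd1 : ∀ y : ℝ, HasDerivAt (fun y => -Real.exp (-Real.pi * y ^ 2))
      (2 * Real.pi * (y * Real.exp (-Real.pi * y ^ 2))) y := by
    intro y
    convert! (((hasDerivAt_pow 2 y).const_mul (-Real.pi)).exp).neg using 1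
    simp
    ring
  have hlim : Tendsto (fun y : ℝ => Real.exp (-Real.pi * y ^ 2)) atTop (𝓝 0) := by
    refine Real.tendsto_exp_atBot.comp ?_
    exact (tendsto_pow_atTop two_ne_zero).const_mul_atTop_of_neg (by linarith)
  have hi1 : IntegrableOn (fun y : ℝ => 2 * Real.pi * (y * Real.exp (-Real.pi * y ^ 2)))
      (Set.Ioi 0) := ((integrable_mul_exp_neg_mul_sq hpi).const_mul _).integrableOn
  have h1 : ∫ y in Set.Ioi (0 : ℝ), 2 * Real.pi * (y * Real.exp (-Real.pi * y ^ 2)) = 1 := by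
    rw [integral_Ioi_of_hasDerivAt_of_tendsto' (fun y _ => hd1 y) hi1 hlim.neg]
    simp
  have hd2 : ∀ y : ℝ, HasDerivAt (fun y => -Real.exp (-Real.pi * y ^ 2) * Real.cos (y * z))
      (2 * Real.pi * (y * Real.exp (-Real.pi * y ^ 2)) * Real.cos (y * z) +
        z * (Real.exp (-Real.pi * y ^ 2) * Real.sin (y * z))) y := by
    intro y
    convert! (hd1 y).mul ((hasDerivAt_mul_const z).cos) using 1
    ring
  have hi2 : IntegrableOn (fun y : ℝ => 2 * Real.pi * (y * Real.exp (-Real.pi * y ^ 2)) *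
      Real.cos (y * z)) (Set.Ioi 0) :=
    hi1.mul_bdd (c := 1) (Continuous.aestronglyMeasurable (by fun_prop))
      (ae_of_all _ fun x => Real.abs_cos_le_one _)
  have hi3 : IntegrableOn (fun y : ℝ => z * (Real.exp (-Real.pi * y ^ 2) * Real.sin (y * z)))
      (Set.Ioi 0) := ((integrable_exp_neg_pi_sq_mul (by fun_prop)
        fun x => Real.abs_sin_le_one _).const_mul _).integrableOn
  have hlim2 : Tendsto (fun y : ℝ => -Real.exp (-Real.pi * y ^ 2) * Real.cos (y * z))
      atTop (𝓝 0) := by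
    have := hlim.neg
    rw [neg_zero] at this
    refine this.zero_mul_isBoundedUnder_le ⟨1, ?_⟩
    simp only [eventually_map]
    exact Eventually.of_forall fun x => Real.abs_cos_le_one _
  have h2 := integral_Ioi_of_hasDerivAt_of_tendsto' (fun y _ => hd2 y) (hi2.add hi3) hlim2
  have h3 : ∫ y in Set.Ioi (0 : ℝ), (2 * Real.pi * (y * Real.exp (-Real.pi * y ^ 2)) *
      Real.cos (y * z) + z * (Real.exp (-Real.pi * y ^ 2) * Real.sin (y * z))) = 1 := by
    rw [h2]
    simp
  rw [integral_add hi2 hi3, integral_const_mul] at h3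
  have h4 : |∫ y in Set.Ioi (0 : ℝ), 2 * Real.pi * (y * Real.exp (-Real.pi * y ^ 2)) *
      Real.cos (y * z)| ≤ 1 := by
    rw [← h1, ← Real.norm_eq_abs]
    refine norm_integral_le_of_norm_le hi1 ?_
    refine (ae_restrict_mem measurableSet_Ioi).mono fun y hy => ?_
    have hy0 : 0 < y := hy
    have hpos : 0 ≤ 2 * Real.pi * (y * Real.exp (-Real.pi * y ^ 2)) := by positivity
    rw [norm_mul, Real.norm_eq_abs, abs_of_nonneg hpos]
    exact mul_le_of_le_one_right hpos (Real.abs_cos_le_one _)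
  rw [abs_le] at h4 ⊢
  constructor <;> linarith [h4.1, h4.2]

/-- The three terms of the explicit transform, multiplied by `z`, contribute at most `2`, `2` and
`4`. This decay is what makes `h` integrable. -/
theorem abs_mul_norm_distGaussianHat_le {α : ℝ} (hα : 0 ≤ α) (z : ℝ) :
    |z| * ‖distGaussianHat α z‖ ≤ 8 := by
  rcases eq_or_ne z 0 with rfl | hz
  · simp
  rw [distGaussianHat_eq hα hz, Complex.norm_real, Real.norm_eq_abs, ← abs_mul, mul_sub, mul_add,
    mul_div_cancel₀ _ hz]
  set S := ∫ y in Set.Ioi (0 : ℝ), Real.exp (-Real.pi * y ^ 2) * Real.sin (y * z)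
  have hS : |z * S| ≤ 2 := abs_mul_integral_gaussian_mul_sin_le z
  have hs := Real.abs_sin_le_one (α * z)
  have hc := Real.abs_cos_le_one (α * z)
  have h1 : |z| * Real.exp (-(z ^ 2 / (4 * Real.pi))) ≤ 2 := by
    rw [Real.exp_neg, ← div_eq_mul_inv, div_le_iff₀ (Real.exp_pos _)]
    -- With `e^u ≥ 1 + u`, the claim reduces to `|z| ≤ 2(1 + z²/16)`, that is `(|z| - 4)² ≥ 0`.
    have h2 : z ^ 2 / 16 ≤ z ^ 2 / (4 * Real.pi) :=
      div_le_div_of_nonneg_left (sq_nonneg z) (by linarith [Real.pi_pos])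
        (by linarith [Real.pi_le_four])
    have h3 := Real.add_one_le_exp (z ^ 2 / (4 * Real.pi))
    nlinarith [sq_nonneg (|z| - 4), sq_abs z]
  have e1 : |2 * Real.sin (α * z)| ≤ 2 := by
    rw [abs_mul, abs_two]
    linarith
  have e2 : |z * (Real.cos (α * z) * Real.exp (-(z ^ 2 / (4 * Real.pi))))| ≤ 2 := by
    rw [abs_mul, abs_mul, abs_of_pos (Real.exp_pos _)]
    have := mul_le_of_le_one_left (Real.exp_pos (-(z ^ 2 / (4 * Real.pi)))).le hc
    exact (mul_le_mul_of_nonneg_left this (abs_nonneg z)).trans h1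
  have e3 : |z * (2 * Real.sin (α * z) * S)| ≤ 4 := by
    rw [show z * (2 * Real.sin (α * z) * S) = 2 * Real.sin (α * z) * (z * S) by ring, abs_mul]
    nlinarith [abs_nonneg (z * S), abs_nonneg (2 * Real.sin (α * z))]
  calc _ ≤ |2 * Real.sin (α * z) +
        z * (Real.cos (α * z) * Real.exp (-(z ^ 2 / (4 * Real.pi))))| +
        |z * (2 * Real.sin (α * z) * S)| := abs_sub _ _
    _ ≤ |2 * Real.sin (α * z)| +
        |z * (Real.cos (α * z) * Real.exp (-(z ^ 2 / (4 * Real.pi))))| +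
        |z * (2 * Real.sin (α * z) * S)| := by gcongr; exact abs_add_le _ _
    _ ≤ 8 := by linarith

theorem hFun_eq {d α : ℝ} (hd : d < 1) (hα : 0 ≤ α) (t : ℝ) :
    hFun d α t = ‖distGaussianHat α (√(1 - d) * t)‖ ^ (1 / (1 - d)) := by
  have hs : √(1 - d) ≠ 0 := (Real.sqrt_pos.2 (by linarith)).ne'
  rw [hFun]
  split_ifs with ht
  · rw [ht, mul_zero, distGaussianHat_zero hα, Complex.norm_real, Real.norm_eq_abs,
      abs_of_nonneg (by linarith)]
  · rw [distGaussianHat_eq hα (mul_ne_zero hs ht), Complex.norm_real, Real.norm_eq_abs, mul_pow,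
      Real.sq_sqrt (by linarith)]
    simp only [mul_assoc]

theorem continuous_hFun {d α : ℝ} (hd : d < 1) (hα : 0 ≤ α) : Continuous (hFun d α) := by
  rw [funext (hFun_eq hd hα)]
  have := continuous_distGaussianHat hα
  exact Continuous.rpow_const (by fun_prop) fun _ =>
    Or.inr (one_div_nonneg.2 (by linarith))

theorem hFun_nonneg {d α : ℝ} (hd : d < 1) (hα : 0 ≤ α) (t : ℝ) : 0 ≤ hFun d α t := by
  rw [hFun_eq hd hα]
  exact Real.rpow_nonneg (norm_nonneg _) _

/-- The bounds on `|f̂|` and on `|z| |f̂|` add up to `(1 + |z|) |f̂| ≤ (2α + 1) + 8`. The power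
`1/(1 - d)` of `(1 + |z|)⁻¹` is integrable exactly because `d > 0` makes the exponent exceed `1`. -/
theorem integrable_hFun {d α : ℝ} (hd0 : 0 < d) (hd : d < 1) (hα : 0 ≤ α) :
    Integrable (hFun d α) := by
  have hs : √(1 - d) ≠ 0 := (Real.sqrt_pos.2 (by linarith)).ne'
  have hq : 1 < 1 / (1 - d) := by
    rw [lt_div_iff₀ (by linarith)]
    linarith
  have hJ : Integrable fun z : ℝ => (1 + ‖z‖) ^ (-(1 / (1 - d))) :=
    integrable_one_add_norm (by simpa using hq)
  refine ((hJ.comp_mul_left' hs).const_mul ((2 * α + 9) ^ (1 / (1 - d)))).mono'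
    (continuous_hFun hd hα).aestronglyMeasurable (ae_of_all _ fun t => ?_)
  rw [Real.norm_eq_abs, abs_of_nonneg (hFun_nonneg hd hα t), hFun_eq hd hα]
  set z := √(1 - d) * t
  have hz : 0 < 1 + ‖z‖ := by positivity
  rw [Real.rpow_neg hz.le, ← div_eq_mul_inv, ← Real.div_rpow (by linarith) hz.le]
  refine Real.rpow_le_rpow (norm_nonneg _) ?_ (by linarith)
  rw [le_div_iff₀ hz, Real.norm_eq_abs z]
  linarith [abs_mul_norm_distGaussianHat_le hα z, norm_distGaussianHat_le hα z]

end DistGaussian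

/-! ### Fourier inversion on the complement of a subspace. -/

section FourierSlice

open scoped FourierTransform

variable {E : Type*} [NormedAddCommGroup E] [InnerProductSpace ℝ E] [FiniteDimensional ℝ E]
  [MeasurableSpace E] [BorelSpace E] {ι : Type*} [Fintype ι]

/-- An isometric embedding and the orthogonal complement of its range split the volume. -/
theorem measurePreserving_isometry_add_orthogonal {F : Type*} [NormedAddCommGroup F]
    [InnerProductSpace ℝ F] [FiniteDimensional ℝ F] [MeasurableSpace F] [BorelSpace F]
    (A : E →ₗᵢ[ℝ] F) :
    MeasurePreserving (fun q : E × (LinearMap.range A.toLinearMap)ᗮ => A q.1 + (q.2 : F))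
      (volume.prod volume) volume := by
  have h1 := (A.equivRange.measurePreserving).prod
    (MeasurePreserving.id (volume : Measure (LinearMap.range A.toLinearMap)ᗮ))
  have h2 := WithLp.volume_preserving_toLp (LinearMap.range A.toLinearMap)
    (LinearMap.range A.toLinearMap)ᗮ
  have h3 := ((LinearMap.range A.toLinearMap).orthogonalDecomposition).symm.measurePreserving
  have h4 := h3.comp (h2.comp h1)
  convert! h4 using 1

theorem abs_prod_le_of_gaussian_bound {f : ι → ℝ → ℝ} {M b : ℝ}
    (hf : ∀ j t, |f j t| ≤ M * Real.exp (-b * t ^ 2)) (z : EuclideanSpace ℝ ι) :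
    |∏ j, f j (z j)| ≤ M ^ Fintype.card ι * Real.exp (-b * ‖z‖ ^ 2) := by
  rw [EuclideanSpace.real_norm_sq_eq, Finset.mul_sum, Real.exp_sum, Finset.abs_prod,
    ← Finset.card_univ, ← Finset.prod_const, ← Finset.prod_mul_distrib]
  exact Finset.prod_le_prod (fun _ _ => abs_nonneg _) fun j _ => hf j _

/-- Fourier inversion on the orthogonal complement of a subspace: the integral of a product function
over a subspace is the integral of its Fourier transform over the orthogonal complement. -/
theorem integral_prod_comp_isometry_eq (A : E →ₗᵢ[ℝ] EuclideanSpace ℝ ι) {f : ι → ℝ → ℝ}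
    (hc : ∀ j, Continuous (f j)) {M b : ℝ} (hb : 0 < b)
    (hf : ∀ j t, |f j t| ≤ M * Real.exp (-b * t ^ 2))
    (hint : Integrable fun w : (LinearMap.range A.toLinearMap)ᗮ =>
      ∏ j, 𝓕 (fun t => (f j t : ℂ)) ((w : EuclideanSpace ℝ ι) j)) :
    ((∫ x, ∏ j, f j (A x j) : ℝ) : ℂ) = ∫ w : (LinearMap.range A.toLinearMap)ᗮ,
      ∏ j, 𝓕 (fun t => (f j t : ℂ)) ((w : EuclideanSpace ℝ ι) j) := by
  set W := (LinearMap.range A.toLinearMap)ᗮ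
  have hmp := measurePreserving_isometry_add_orthogonal A
  have hfi : ∀ j, Integrable (f j) := fun j =>
    ((integrable_exp_neg_mul_sq hb).const_mul M).mono' (hc j).aestronglyMeasurable
      (ae_of_all _ (hf j))
  let P : EuclideanSpace ℝ ι → ℂ := fun z => ∏ j, (f j (z j) : ℂ)
  have hPc : Continuous P := continuous_finsetProd _ fun j _ => by
    have := hc j
    fun_prop
  have hPi : Integrable P := by
    have h1 : Integrable fun z : ι → ℝ => ∏ j, (f j (z j) : ℂ) :=
      Integrable.fintype_prod fun j => (hfi j).ofReal
    exact (PiLp.volume_preserving_ofLp ι).integrable_comp_of_integrable h1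
  -- `G` integrates `P` over the translates of the range, so `G 0` is the wanted integral. Its
  -- transform is that of `P` restricted to `W`, which factorises over the coordinates.
  let G : W → ℂ := fun y => ∫ x, P (A x + y)
  have hPprod : Integrable (fun q : E × W => P (A q.1 + q.2)) (volume.prod volume) :=
    hmp.integrable_comp_of_integrable hPi
  have hGi : Integrable G := hPprod.integral_prod_right
  have horth : ∀ x (y : W), ⟪A x, (y : EuclideanSpace ℝ ι)⟫ = 0 := fun x y =>
    Submodule.inner_right_of_mem_orthogonal (LinearMap.mem_range_self A.toLinearMap x) y.2
  have hPbound : ∀ z, ‖P z‖ ≤ M ^ Fintype.card ι * Real.exp (-b * ‖z‖ ^ 2) := fun z => by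
    rw [show P z = ((∏ j, f j (z j) : ℝ) : ℂ) by simp [P], Complex.norm_real]
    exact abs_prod_le_of_gaussian_bound hf z
  have hgauss := integrable_exp_neg_mul_norm_sq (W := E) hb
  have hMn : 0 ≤ M ^ Fintype.card ι := by
    have := (norm_nonneg _).trans (hPbound 0)
    simpa using this
  -- Pointwise inversion at `0` needs continuity there. Domination is uniform in `y` since `‖A x +
  -- y‖ ≥ ‖x‖` by orthogonality.
  have hGc : Continuous G := by
    refine continuous_of_dominated (bound := fun x => M ^ Fintype.card ι *
      Real.exp (-b * ‖x‖ ^ 2)) (fun y => ?_) (fun y => ae_of_all _ fun x => ?_)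
      (hgauss.const_mul _) (ae_of_all _ fun x => ?_)
    · exact (hPc.comp (A.continuous.add continuous_const)).aestronglyMeasurable
    · refine (hPbound _).trans (mul_le_mul_of_nonneg_left (Real.exp_le_exp.2 ?_) hMn)
      have h1 := norm_add_sq_real (A x) (y : EuclideanSpace ℝ ι)
      rw [horth, A.norm_map] at h1
      have h2 : ‖x‖ ^ 2 ≤ ‖A x + (y : EuclideanSpace ℝ ι)‖ ^ 2 := by
        rw [h1]
        nlinarith [sq_nonneg ‖(y : EuclideanSpace ℝ ι)‖]
      nlinarith
    · exact hPc.comp (continuous_const.add continuous_subtype_val)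
  have hFG : 𝓕 G = fun w : W => ∏ j, 𝓕 (fun t => (f j t : ℂ)) ((w : EuclideanSpace ℝ ι) j) := by
    ext w
    let K : EuclideanSpace ℝ ι → ℂ := fun z =>
      Complex.exp (((-2 * Real.pi * ⟪z, (w : EuclideanSpace ℝ ι)⟫ : ℝ) : ℂ) * Complex.I) * P z
    have hKc : Continuous K := by fun_prop
    have hKi : Integrable K := by
      refine hPi.norm.mono' hKc.aestronglyMeasurable (ae_of_all _ fun z => ?_)
      rw [norm_mul, Complex.norm_exp_ofReal_mul_I, one_mul]
    -- The phase ignores `A x`, which is orthogonal to `w`, so it may be moved inside the fibre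
    -- integral.
    have h1 : 𝓕 G w = ∫ y : W, ∫ x, K (A x + y) := by
      rw [Real.fourier_eq']
      congr 1
      ext y
      rw [smul_eq_mul, ← integral_const_mul]
      congr 1
      ext x
      simp only [K]
      rw [inner_add_left, horth, zero_add]
      rfl
    have h2 : ∫ y : W, ∫ x, K (A x + y) = ∫ z, K z := by
      rw [← integral_prod_symm (fun q : E × W => K (A q.1 + q.2))
        (hmp.integrable_comp_of_integrable hKi), ← hmp.map_eq,
        integral_map hmp.aemeasurable hKc.aestronglyMeasurable]
    rw [h1, h2, ← (PiLp.volume_preserving_toLp ι).map_eq,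
      integral_map (PiLp.volume_preserving_toLp ι).aemeasurable hKc.aestronglyMeasurable]
    have h3 : ∀ z : ι → ℝ, K (WithLp.toLp 2 z) = ∏ j, Complex.exp
        (((-2 * Real.pi * z j * (w : EuclideanSpace ℝ ι) j : ℝ) : ℂ) * Complex.I) *
          (f j (z j) : ℂ) := by
      intro z
      rw [Finset.prod_mul_distrib, ← Complex.exp_sum]
      simp only [K, P]
      congr 2
      rw [PiLp.inner_apply, Finset.mul_sum, Complex.ofReal_sum, Finset.sum_mul]
      refine Finset.sum_congr rfl fun j _ => ?_
      simp
      ring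
    simp_rw [h3]
    rw [integral_fintype_prod_volume_eq_prod (fun j (t : ℝ) => Complex.exp
        (((-2 * Real.pi * t * (w : EuclideanSpace ℝ ι) j : ℝ) : ℂ) * Complex.I) *
          (f j t : ℂ))]
    refine Finset.prod_congr rfl fun j _ => ?_
    rw [Real.fourier_real_eq_integral_exp_smul]
    rfl
  have hinv := hGi.fourierInv_fourier_eq (by rw [hFG]; exact hint) (v := 0) hGc.continuousAt
  rw [Real.fourierInv_eq, hFG] at hinv
  simp only [inner_zero_right, AddChar.map_zero_eq_one, one_smul] at hinv
  rw [hinv, ← integral_complex_ofReal]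
  simp [G, P]

theorem fourier_distGaussian (α w : ℝ) :
    𝓕 (fun t => (distGaussian α t : ℂ)) w = distGaussianHat α (-(2 * Real.pi * w)) := by
  rw [Real.fourier_real_eq_integral_exp_smul, distGaussianHat]
  congr 1
  ext t
  rw [smul_eq_mul, mul_comm]
  congr 2
  push_cast
  ring

/-- From `|t| ≤ d + R` and `(d + R)² ≤ 2(d² + R²)`, at the cost of halving the Gaussian rate. The
free `R` allows one constant for all `j`. -/
theorem distGaussian_le {α R : ℝ} (hα : 0 ≤ α) (hR : α ≤ R) (t : ℝ) :
    |distGaussian α t| ≤ Real.exp (Real.pi * R ^ 2) * Real.exp (-(Real.pi / 2) * t ^ 2) := by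
  rw [distGaussian_eq hα, abs_of_pos (Real.exp_pos _), ← Real.exp_add, Real.exp_le_exp]
  set m := max (|t| - α) 0
  have h1 : |t| ≤ m + R := by linarith [le_max_left (|t| - α) 0]
  have h2 : 0 ≤ m := le_max_right _ _
  have h3 : t ^ 2 ≤ 2 * (m ^ 2 + R ^ 2) := by
    rw [← sq_abs t]
    nlinarith [abs_nonneg t, sq_nonneg (m - R)]
  nlinarith [Real.pi_pos]

theorem distGaussian_le_sum {α : ι → ℝ} (hα : ∀ j, 0 ≤ α j) (j : ι) (t : ℝ) :
    |distGaussian (α j) t| ≤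
      Real.exp (Real.pi * (∑ j, α j) ^ 2) * Real.exp (-(Real.pi / 2) * t ^ 2) :=
  distGaussian_le (hα j) (Finset.single_le_sum (fun i _ => hα i) (Finset.mem_univ j)) t

theorem integrable_prod_distGaussian (A : E →ₗᵢ[ℝ] EuclideanSpace ℝ ι) {α : ι → ℝ}
    (hα : ∀ j, 0 ≤ α j) : Integrable fun x => ∏ j, distGaussian (α j) (A x j) := by
  refine ((integrable_exp_neg_mul_norm_sq (W := E) (half_pos Real.pi_pos)).const_mul
    (Real.exp (Real.pi * (∑ j, α j) ^ 2) ^ Fintype.card ι)).mono'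
    (Continuous.aestronglyMeasurable (continuous_finsetProd _ fun j _ => ?_))
    (ae_of_all _ fun x => ?_)
  · have := continuous_distGaussian (α j)
    have := A.continuous
    fun_prop
  · have := abs_prod_le_of_gaussian_bound (f := fun j => distGaussian (α j))
      (distGaussian_le_sum hα) (A x)
    rwa [A.norm_map] at this

/-- The integral of a product of the functions `distGaussian` over a subspace is bounded by the
integral of their transforms over the orthogonal complement. -/
theorem integral_prod_distGaussian_le (A : E →ₗᵢ[ℝ] EuclideanSpace ℝ ι) {α : ι → ℝ}
    (hα : ∀ j, 0 ≤ α j)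
    (hint : Integrable fun w : (LinearMap.range A.toLinearMap)ᗮ =>
      ∏ j, ‖distGaussianHat (α j) ((w : EuclideanSpace ℝ ι) j)‖) :
    ∫ x, ∏ j, distGaussian (α j) (A x j) ≤
      ((2 * Real.pi) ^ Module.finrank ℝ (LinearMap.range A.toLinearMap)ᗮ)⁻¹ *
        ∫ w : (LinearMap.range A.toLinearMap)ᗮ,
          ∏ j, ‖distGaussianHat (α j) ((w : EuclideanSpace ℝ ι) j)‖ := by
  set W := (LinearMap.range A.toLinearMap)ᗮ
  have h2pi : 0 < 2 * Real.pi := by linarith [Real.pi_pos]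
  -- `𝓕` has kernel `e^{-2πixw}` and `f̂` has `e^{ixz}`; the dilation by `2π` between them, on `W`,
  -- yields the factor `(2π)^{-dim W}`.
  let Q : W → ℝ := fun w => ∏ j, ‖distGaussianHat (α j) ((w : EuclideanSpace ℝ ι) j)‖
  have hnorm : ∀ w : W, ‖∏ j, 𝓕 (fun t => (distGaussian (α j) t : ℂ))
      ((w : EuclideanSpace ℝ ι) j)‖ = Q ((2 * Real.pi) • w) := by
    intro w
    rw [norm_prod]
    refine Finset.prod_congr rfl fun j _ => ?_
    rw [fourier_distGaussian, norm_distGaussianHat_neg (hα j)]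
    rfl
  have hQ : Integrable fun w : W => Q ((2 * Real.pi) • w) := hint.comp_smul h2pi.ne'
  have hcont : Continuous fun w : W => ∏ j, 𝓕 (fun t => (distGaussian (α j) t : ℂ))
      ((w : EuclideanSpace ℝ ι) j) := by
    simp_rw [fourier_distGaussian]
    exact continuous_finsetProd _ fun j _ => by
      have := continuous_distGaussianHat (hα j)
      fun_prop
  have hi : Integrable fun w : W => ∏ j, 𝓕 (fun t => (distGaussian (α j) t : ℂ))
      ((w : EuclideanSpace ℝ ι) j) :=
    hQ.mono' hcont.aestronglyMeasurable (ae_of_all _ fun w => (hnorm w).le)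
  have key := integral_prod_comp_isometry_eq A (f := fun j => distGaussian (α j))
    (fun j => continuous_distGaussian _) (half_pos Real.pi_pos) (distGaussian_le_sum hα) hi
  calc ∫ x, ∏ j, distGaussian (α j) (A x j)
      ≤ ‖((∫ x, ∏ j, distGaussian (α j) (A x j) : ℝ) : ℂ)‖ := by
        rw [Complex.norm_real]
        exact le_abs_self _
    _ ≤ ∫ w : W, Q ((2 * Real.pi) • w) := by
        rw [key]
        exact (norm_integral_le_integral_norm _).trans_eq (by simp_rw [hnorm]; rfl)
    _ = _ := by
        rw [Measure.integral_comp_smul, smul_eq_mul, abs_of_pos (by positivity)]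

end FourierSlice

/-! ### Complementary frame and the bound for sections of a box. -/

section SectionBound

variable {E : Type*} [NormedAddCommGroup E] [InnerProductSpace ℝ E]
  {ι : Type*} [Fintype ι]

/-- The orthogonal projections `b_j` of the standard basis vectors onto the orthogonal complement
of the range of the isometry `x ↦ (⟨u_j, x⟩)_j`. -/
theorem exists_complementary_frame (A : E →ₗᵢ[ℝ] EuclideanSpace ℝ ι) {u : ι → E}
    (hu : ∀ x j, A x j = ⟪u j, x⟫) :
    ∃ b : ι → (LinearMap.range A.toLinearMap)ᗮ,
      (∀ j, ‖b j‖ ^ 2 = 1 - ‖u j‖ ^ 2) ∧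
      (∀ j w, ⟪b j, w⟫ = (w : EuclideanSpace ℝ ι) j) ∧
      ∀ w, ∑ j, ⟪b j, w⟫ • b j = w := by
  classical
  have hcoord : ∀ (z : EuclideanSpace ℝ ι) j, ⟪EuclideanSpace.single j (1 : ℝ), z⟫ = z j :=
    fun z j => by simp [EuclideanSpace.inner_single_left]
  -- `A (u_j)` is the projection of `e_j` onto the range, as `⟨e_j, A x⟩ = ⟨u_j, x⟩ = ⟨A u_j, A x⟩`.
  have hmem : ∀ j, EuclideanSpace.single j (1 : ℝ) - A (u j) ∈
      (LinearMap.range A.toLinearMap)ᗮ := by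
    intro j
    rw [Submodule.mem_orthogonal']
    rintro _ ⟨x, rfl⟩
    change ⟪_, A x⟫ = 0
    rw [inner_sub_left, A.inner_map_map, hcoord, hu, sub_self]
  have hinner : ∀ j (w : (LinearMap.range A.toLinearMap)ᗮ),
      ⟪(⟨_, hmem j⟩ : (LinearMap.range A.toLinearMap)ᗮ), w⟫ = (w : EuclideanSpace ℝ ι) j := by
    intro j w
    have h0 : ⟪A (u j), (w : EuclideanSpace ℝ ι)⟫ = 0 :=
      Submodule.inner_right_of_mem_orthogonal (LinearMap.mem_range_self A.toLinearMap (u j)) w.2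
    rw [Submodule.coe_inner, inner_sub_left, hcoord, h0, sub_zero]
  refine ⟨fun j => ⟨_, hmem j⟩, fun j => ?_, hinner, fun w => ?_⟩
  · rw [← real_inner_self_eq_norm_sq, hinner]
    simp [hu]
  · refine ext_inner_right ℝ fun y => ?_
    rw [sum_inner, Submodule.coe_inner, PiLp.inner_apply]
    refine Finset.sum_congr rfl fun j _ => ?_
    rw [inner_smul_left, hinner, hinner]
    simp [mul_comm]

variable [FiniteDimensional ℝ E] [MeasurableSpace E] [BorelSpace E]

theorem hFactor_nonneg {d α : ℝ} (hd : d ≤ 1) (hα : 0 ≤ α) : 0 ≤ hFactor d α := by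
  rw [hFactor]
  split_ifs with h
  · linarith
  · exact Real.rpow_nonneg (integral_nonneg fun t => hFun_nonneg (lt_of_le_of_ne hd h) hα t) _

/-- The Brascamp–Lieb bound for the transforms over the orthogonal complement. -/
theorem lintegral_prod_norm_distGaussianHat_le {W : Type*} [NormedAddCommGroup W]
    [InnerProductSpace ℝ W] [FiniteDimensional ℝ W] [MeasurableSpace W] [BorelSpace W]
    {b : ι → W} {d α : ι → ℝ} (hb : ∀ j, ‖b j‖ ^ 2 = 1 - d j)
    (hid : ∀ w, ∑ j, ⟪b j, w⟫ • b j = w) (hd : ∀ j, 0 < d j) (hα : ∀ j, 0 ≤ α j) :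
    ∫⁻ w, ENNReal.ofReal (∏ j, ‖distGaussianHat (α j) ⟪b j, w⟫‖) ≤
      ENNReal.ofReal (∏ j, hFactor (d j) (α j)) := by
  classical
  have hd1 : ∀ j, d j ≤ 1 := fun j => by linarith [sq_nonneg ‖b j‖, hb j]
  -- For `d_j = 1` the transform is evaluated only at `0`, giving the constant `2α_j + 1`. Such
  -- indices leave the frame and their factors come out of the integral.
  have hb0 : ∀ j : {j // ¬ d j ≠ 1}, b j = 0 := fun j => by
    have h1 := hb j
    rw [not_ne_iff.1 j.2, sub_self] at h1
    simpa using h1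
  have hlt : ∀ j : {j // d j ≠ 1}, d j < 1 := fun j => lt_of_le_of_ne (hd1 j) j.2
  have hnorm : ∀ j : {j // d j ≠ 1}, ‖b j‖ = √(1 - d j) := fun j => by
    rw [← hb, Real.sqrt_sq (norm_nonneg _)]
  have hnpos : ∀ j : {j // d j ≠ 1}, 0 < ‖b j‖ := fun j => by
    rw [hnorm]
    exact Real.sqrt_pos.2 (sub_pos.2 (hlt j))
  have hbl := geometric_brascampLieb (ι := {j // d j ≠ 1}) (p := fun j => 1 - d j)
    (w := fun j => ‖b j‖⁻¹ • b j) (h := fun j => hFun (d j) (α j))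
    (fun j => sub_pos.2 (hlt j))
    (fun j => by rw [norm_smul, norm_inv, norm_norm, inv_mul_cancel₀ (hnpos j).ne'])
    (fun x => by
      conv_rhs => rw [← hid x]
      rw [← Fintype.sum_subtype_add_sum_subtype (fun j => d j ≠ 1)]
      rw [Finset.sum_eq_zero (s := (Finset.univ : Finset {j // ¬ d j ≠ 1}))
        (fun j _ => by rw [hb0 j, smul_zero]), add_zero]
      refine Finset.sum_congr rfl fun j _ => ?_
      rw [inner_smul_left, smul_smul, smul_smul]
      congr 1
      rw [← hb]
      have := (hnpos j).ne'
      simp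
      field_simp)
    (fun j => continuous_hFun (hlt j) (hα j)) (fun j => hFun_nonneg (hlt j) (hα j))
    (fun j => integrable_hFun (hd j) (hlt j) (hα j))
  have hprod : ∀ w, ∏ j, ‖distGaussianHat (α j) ⟪b j, w⟫‖ =
      (∏ j : {j // ¬ d j ≠ 1}, hFactor (d j) (α j)) *
        ∏ j : {j // d j ≠ 1}, hFun (d j) (α j) ⟪‖b j‖⁻¹ • b j, w⟫ ^ (1 - d j) := by
    intro w
    rw [← Fintype.prod_subtype_mul_prod_subtype (fun j => d j ≠ 1), mul_comm]
    congr 1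
    · refine Finset.prod_congr rfl fun j _ => ?_
      rw [hb0 j, inner_zero_left, distGaussianHat_zero (hα j), hFactor,
        if_pos (not_ne_iff.1 j.2), Complex.norm_real, Real.norm_eq_abs,
        abs_of_nonneg (by linarith [hα j])]
    · refine Finset.prod_congr rfl fun j _ => ?_
      rw [hFun_eq (hlt j) (hα j), ← Real.rpow_mul (norm_nonneg _),
        one_div_mul_cancel (sub_pos.2 (hlt j)).ne', Real.rpow_one, inner_smul_left, ← hnorm]
      simp only [map_inv₀, conj_trivial]
      rw [mul_inv_cancel_left₀ (hnpos j).ne']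
  have hC : 0 ≤ ∏ j : {j // ¬ d j ≠ 1}, hFactor (d j) (α j) :=
    Finset.prod_nonneg fun j _ => hFactor_nonneg (hd1 j) (hα j)
  simp_rw [hprod, ENNReal.ofReal_mul hC]
  rw [lintegral_const_mul' _ _ ENNReal.ofReal_ne_top,
    ← Fintype.prod_subtype_mul_prod_subtype (fun j => d j ≠ 1), mul_comm (∏ _, _),
    ENNReal.ofReal_mul hC]
  refine mul_le_mul_right (hbl.trans_eq ?_) _
  congr 1
  refine Finset.prod_congr rfl fun j _ => ?_
  rw [hFactor, if_neg j.2]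

theorem integral_prod_distGaussian_le_prod_hFactor (A : E →ₗᵢ[ℝ] EuclideanSpace ℝ ι) {u : ι → E}
    (hu : ∀ x j, A x j = ⟪u j, x⟫) (hu0 : ∀ j, u j ≠ 0) {α : ι → ℝ} (hα : ∀ j, 0 ≤ α j) :
    ∫ x, ∏ j, distGaussian (α j) (A x j) ≤
      1 / (2 * Real.pi) ^ ((Fintype.card ι : ℤ) - (Module.finrank ℝ E : ℤ)) *
        ∏ j, hFactor (‖u j‖ ^ 2) (α j) := by
  obtain ⟨b, hb, hbw, hid⟩ := exists_complementary_frame A hu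
  have hd : ∀ j, 0 < ‖u j‖ ^ 2 := fun j => by have := norm_pos_iff.2 (hu0 j); positivity
  have hd1 : ∀ j, ‖u j‖ ^ 2 ≤ 1 := fun j => by linarith [sq_nonneg ‖b j‖, hb j]
  have hl := lintegral_prod_norm_distGaussianHat_le hb hid hd hα
  simp_rw [hbw] at hl
  have hnn : ∀ w : (LinearMap.range A.toLinearMap)ᗮ,
      0 ≤ ∏ j, ‖distGaussianHat (α j) ((w : EuclideanSpace ℝ ι) j)‖ := fun w =>
    Finset.prod_nonneg fun j _ => norm_nonneg _
  have hmeas : AEStronglyMeasurable (fun w : (LinearMap.range A.toLinearMap)ᗮ =>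
      ∏ j, ‖distGaussianHat (α j) ((w : EuclideanSpace ℝ ι) j)‖) volume :=
    (continuous_finsetProd _ fun j _ => by
      have := continuous_distGaussianHat (hα j)
      fun_prop : Continuous _).aestronglyMeasurable
  -- The integrability that Fourier inversion requires is itself a consequence of the Brascamp–Lieb
  -- bound, which was stated for the lower integral for this reason.
  have hint : Integrable fun w : (LinearMap.range A.toLinearMap)ᗮ =>
      ∏ j, ‖distGaussianHat (α j) ((w : EuclideanSpace ℝ ι) j)‖ :=
    ⟨hmeas, (hasFiniteIntegral_iff_ofReal (ae_of_all _ hnn)).2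
      (hl.trans_lt ENNReal.ofReal_lt_top)⟩
  have hdim : (Fintype.card ι : ℤ) - (Module.finrank ℝ E : ℤ) =
      (Module.finrank ℝ (LinearMap.range A.toLinearMap)ᗮ : ℤ) := by
    have h1 := Submodule.finrank_add_finrank_orthogonal (LinearMap.range A.toLinearMap)
    rw [LinearMap.finrank_range_of_inj (f := A.toLinearMap) A.injective,
      finrank_euclideanSpace] at h1
    omega
  rw [hdim, zpow_natCast, one_div]
  refine (integral_prod_distGaussian_le A hα hint).trans ?_
  refine mul_le_mul_of_nonneg_left ?_ (by positivity)
  rw [integral_eq_lintegral_of_nonneg_ae (ae_of_all _ hnn) hmeas]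
  exact ENNReal.toReal_le_of_le_ofReal
    (Finset.prod_nonneg fun j _ => hFactor_nonneg (hd1 j) (hα j)) hl

theorem willsFunctional_mono {s t : Set E} (hst : s ⊆ t) (hs : s.Nonempty)
    (ht : Bornology.IsBounded t) : willsFunctional s ≤ willsFunctional t := by
  refine integral_mono (integrable_willsFunctional hs (ht.subset hst))
    (integrable_willsFunctional (hs.mono hst) ht) fun x => ?_
  simp only [Real.exp_le_exp, neg_mul, neg_le_neg_iff]
  exact mul_le_mul_of_nonneg_left (pow_le_pow_left₀ Metric.infDist_nonneg
    (Metric.infDist_le_infDist_of_subset hst hs) 2) Real.pi_pos.le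

/-- The Wills functional of a set which is mapped into a box by an isometric embedding. -/
theorem willsFunctional_le_integral_prod_distGaussian (A : E →ₗᵢ[ℝ] EuclideanSpace ℝ ι)
    {α : ι → ℝ} (hα : ∀ j, 0 ≤ α j) {s : Set E} (hs : s.Nonempty)
    (hsα : ∀ x ∈ s, ∀ j, |A x j| ≤ α j) :
    willsFunctional s ≤ ∫ x, ∏ j, distGaussian (α j) (A x j) := by
  refine integral_mono_of_nonneg (ae_of_all _ fun x => (Real.exp_pos _).le)
    (integrable_prod_distGaussian A hα) (ae_of_all _ fun x => ?_)
  simp only [distGaussian]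
  rw [← Real.exp_sum, Real.exp_le_exp, ← Finset.mul_sum]
  -- The left side is the distance from `A x` to the box, which contains the isometric image of `s`.
  have h1 : √(∑ j, Metric.infDist (A x j) (Set.Icc (-α j) (α j)) ^ 2) ≤ Metric.infDist x s := by
    rw [Metric.le_infDist hs]
    intro y hy
    rw [dist_eq_norm, ← A.norm_map, map_sub, EuclideanSpace.norm_eq]
    refine Real.sqrt_le_sqrt (Finset.sum_le_sum fun j _ => ?_)
    refine pow_le_pow_left₀ Metric.infDist_nonneg ?_ 2
    exact Metric.infDist_le_dist_of_mem (abs_le.1 (hsα y hy j))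
  have h2 := (Real.sqrt_le_left Metric.infDist_nonneg).1 h1
  nlinarith [Real.pi_pos]

end SectionBound

/-! ### Consequences of John's position and the embedding of `H`. -/

section JohnPosition

variable {n m : ℕ} {c : Fin m → ℝ} {v : Fin m → EuclideanSpace ℝ (Fin n)}

/-- The unit ball has a unique supporting hyperplane at a contact point. -/
theorem inner_le_one_of_mem_frontier {K : Set (EuclideanSpace ℝ (Fin n))} (hc : Convex ℝ K)
    (hball : Metric.closedBall 0 1 ⊆ K) {v x : EuclideanSpace ℝ (Fin n)} (hv : v ∈ frontier K)
    (hv1 : ‖v‖ = 1) (hx : x ∈ K) : ⟪v, x⟫ ≤ 1 := by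
  have h0 : (0 : EuclideanSpace ℝ (Fin n)) ∈ interior K :=
    interior_mono hball (mem_interior_iff_mem_nhds.2 (Metric.closedBall_mem_nhds 0 one_pos))
  obtain ⟨f, hf⟩ := geometric_hahn_banach_open_point hc.interior isOpen_interior hv.2
  have hfK : ∀ y ∈ K, f y ≤ f v := by
    intro y hy
    have h1 : y ∈ closure (interior K) := by
      rw [hc.closure_interior_eq_closure_of_nonempty_interior ⟨0, h0⟩]
      exact subset_closure hy
    exact closure_minimal (fun z hz => (hf z hz).le)
      (isClosed_le f.continuous continuous_const) h1
  obtain ⟨u, hu⟩ : ∃ u, ∀ y, f y = ⟪u, y⟫ :=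
    ⟨(InnerProductSpace.toDual ℝ _).symm f, fun y => InnerProductSpace.toDual_symm_apply.symm⟩
  have hu0 : 0 < ‖u‖ := by
    rw [norm_pos_iff]
    rintro rfl
    have := hf 0 h0
    simp [hu] at this
  -- The functional is maximal at `v` over `K`, hence over the unit ball. This is equality in
  -- Cauchy–Schwarz, so `u = ‖u‖ v`.
  have h2 : ‖u‖ ≤ ⟪u, v⟫ := by
    have h3 := hfK (‖u‖⁻¹ • u) (hball (by
      rw [mem_closedBall_zero_iff, norm_smul, norm_inv, norm_norm, inv_mul_cancel₀ hu0.ne']))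
    rw [hu, hu, inner_smul_right, real_inner_self_eq_norm_sq, sq,
      inv_mul_cancel_left₀ hu0.ne'] at h3
    exact h3
  have h4 : ⟪u, v⟫ = ‖u‖ * ‖v‖ := by
    refine le_antisymm (real_inner_le_norm u v) ?_
    rwa [hv1, mul_one]
  have h5 := inner_eq_norm_mul_iff_real.1 h4
  rw [hv1, one_smul] at h5
  have h6 := hfK x hx
  rw [hu, hu, h4, hv1, mul_one, h5, inner_smul_left] at h6
  simp only [conj_trivial] at h6
  rw [norm_smul, norm_norm, hv1, mul_one] at h6
  exact le_of_mul_le_mul_left (by linarith) hu0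

theorem subset_contactPolytope {K : ConvexBody (EuclideanSpace ℝ (Fin n))}
    (hsymm : ∀ x ∈ K, -x ∈ K)
    (hK : IsJohnDecomposition (K : Set (EuclideanSpace ℝ (Fin n))) c v) :
    (K : Set (EuclideanSpace ℝ (Fin n))) ⊆ contactPolytope v := by
  intro x hx j
  have h := fun y hy => inner_le_one_of_mem_frontier (x := y) K.convex hK.ball_subset
    (hK.mem_frontier j) (hK.norm_eq_one j) hy
  have h1 := h x hx
  have h2 := h (-x) (hsymm x hx)
  rw [inner_neg_right] at h2
  rw [real_inner_comm, abs_le]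
  constructor <;> linarith

/-- By Parseval, `‖x‖² = ∑ c_j ⟨v_j, x⟩² ≤ ∑ c_j` on `L`. -/
theorem isBounded_contactPolytope {K : Set (EuclideanSpace ℝ (Fin n))}
    (hK : IsJohnDecomposition K c v) : Bornology.IsBounded (contactPolytope v) := by
  refine (Metric.isBounded_closedBall (x := 0) (r := √(∑ j, c j))).subset fun x hx => ?_
  rw [mem_closedBall_zero_iff]
  refine Real.le_sqrt_of_sq_le ?_
  rw [← real_inner_self_eq_norm_sq, ← sum_mul_inner_of_decomposition hK.sum_eq]
  refine Finset.sum_le_sum fun j _ => mul_le_of_le_one_right (hK.pos j).le ?_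
  have h1 := hx j
  rw [real_inner_comm] at h1
  rw [← sq]
  exact (sq_le_one_iff_abs_le_one _).2 h1

variable (H : Submodule ℝ (EuclideanSpace ℝ (Fin n)))

theorem inner_starProjection_of_mem {x : EuclideanSpace ℝ (Fin n)} (hx : x ∈ H)
    (y : EuclideanSpace ℝ (Fin n)) : ⟪H.starProjection y, x⟫ = ⟪y, x⟫ := by
  rw [Submodule.inner_starProjection_left_eq_right, Submodule.starProjection_eq_self_iff.2 hx]

theorem mem_indexJ {j : Fin m} : j ∈ indexJ H v ↔ H.starProjection (v j) ≠ 0 := by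
  simp [indexJ]

theorem tildeC_pos {c : ℝ} (hc : 0 < c) {v : EuclideanSpace ℝ (Fin n)}
    (hv : H.starProjection v ≠ 0) : 0 < tildeC H c v := by
  have := norm_pos_iff.2 hv
  rw [tildeC]
  positivity

/-- Keeping one term of Parseval's identity at `x = P_H v_j` gives `c_j ‖x‖⁴ ≤ ‖x‖²`. -/
theorem tildeC_le_one {K : Set (EuclideanSpace ℝ (Fin n))} (hK : IsJohnDecomposition K c v)
    (j : Fin m) : tildeC H (c j) (v j) ≤ 1 := by
  rcases eq_or_ne (H.starProjection (v j)) 0 with h0 | h0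
  · simp [tildeC, h0]
  set x := H.starProjection (v j)
  have hx : x ∈ H := Submodule.starProjection_apply_mem _ _
  have h1 := sum_mul_inner_of_decomposition hK.sum_eq x x
  have h2 : c j * (⟪v j, x⟫ * ⟪v j, x⟫) ≤ ⟪x, x⟫ := by
    rw [← h1]
    exact Finset.single_le_sum (f := fun i => c i * (⟪v i, x⟫ * ⟪v i, x⟫))
      (fun i _ => mul_nonneg (hK.pos i).le (mul_self_nonneg _)) (Finset.mem_univ j)
  rw [← inner_starProjection_of_mem H hx, real_inner_self_eq_norm_sq] at h2
  have h3 : 0 < ‖x‖ ^ 2 := by have := norm_pos_iff.2 h0; positivity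
  rw [tildeC]
  refine le_of_mul_le_mul_right ?_ h3
  linarith

theorem alphaOf_eq {a c : ℝ} (hc : 0 ≤ c) {v : EuclideanSpace ℝ (Fin n)}
    (hv : H.starProjection v ≠ 0) : alphaOf H a c v = a * √c := by
  have := norm_ne_zero_iff.2 hv
  rw [alphaOf, tildeC, Real.sqrt_mul hc, Real.sqrt_sq (norm_nonneg _)]
  field_simp

/-- The isometric embedding `x ↦ (√c_j ⟨v_j, x⟩)_{j ∈ J}` of `H`. -/
theorem exists_isometry_indexJ {K : Set (EuclideanSpace ℝ (Fin n))}
    (hK : IsJohnDecomposition K c v) :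
    ∃ A : H →ₗᵢ[ℝ] EuclideanSpace ℝ (indexJ H v),
      ∀ x j, A x j = √(c j) * ⟪v j, (x : EuclideanSpace ℝ (Fin n))⟫ := by
  let L : H →ₗ[ℝ] EuclideanSpace ℝ (indexJ H v) :=
    { toFun := fun x => WithLp.toLp 2 fun j => √(c j) * ⟪v j, (x : EuclideanSpace ℝ (Fin n))⟫
      map_add' := fun x y => by
        ext j
        simp [inner_add_right, mul_add]
      map_smul' := fun r x => by
        ext j
        simp [inner_smul_right]
        ring }
  refine ⟨L.isometryOfInner fun x y => ?_, fun x j => rfl⟩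
  have hsum : ∑ j : indexJ H v, c j * (⟪v j, (x : EuclideanSpace ℝ (Fin n))⟫ *
      ⟪v j, (y : EuclideanSpace ℝ (Fin n))⟫) = ∑ j, c j *
        (⟪v j, (x : EuclideanSpace ℝ (Fin n))⟫ * ⟪v j, (y : EuclideanSpace ℝ (Fin n))⟫) := by
    rw [Finset.sum_coe_sort (indexJ H v) fun j => c j *
      (⟪v j, (x : EuclideanSpace ℝ (Fin n))⟫ * ⟪v j, (y : EuclideanSpace ℝ (Fin n))⟫)]
    -- Indices outside `J` contribute nothing, since `⟨v_j, x⟩ = ⟨P_H v_j, x⟩` for `x ∈ H`.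
    refine Finset.sum_subset (Finset.subset_univ _) fun j _ hj => ?_
    rw [mem_indexJ, not_not] at hj
    rw [← inner_starProjection_of_mem H x.2, hj, inner_zero_left, zero_mul, mul_zero]
  rw [Submodule.coe_inner, ← sum_mul_inner_of_decomposition hK.sum_eq, ← hsum, PiLp.inner_apply]
  refine Finset.sum_congr rfl fun j _ => ?_
  have h1 := Real.mul_self_sqrt (hK.pos j).le
  simp only [L, LinearMap.coe_mk, AddHom.coe_mk, RCLike.inner_apply, conj_trivial]
  linear_combination (⟪v j, (x : EuclideanSpace ℝ (Fin n))⟫ *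
    ⟪v j, (y : EuclideanSpace ℝ (Fin n))⟫) * h1

end JohnPosition

theorem proposition4p2 {n m k : ℕ} (K : ConvexBody (EuclideanSpace ℝ (Fin n)))
    (hsymm : ∀ x ∈ K, -x ∈ K)
    (c : Fin m → ℝ) (v : Fin m → EuclideanSpace ℝ (Fin n))
    (hK : IsJohnDecomposition (K : Set (EuclideanSpace ℝ (Fin n))) c v)
    (H : Submodule ℝ (EuclideanSpace ℝ (Fin n))) (hH : Module.finrank ℝ H = k)
    (a : ℝ) (ha : 0 < a) :
    (K : Set (EuclideanSpace ℝ (Fin n))) ⊆ contactPolytope v ∧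
    willsFunctional (a • sectionOf H (K : Set (EuclideanSpace ℝ (Fin n)))) ≤
      willsFunctional (a • sectionOf H (contactPolytope v)) ∧
    willsFunctional (a • sectionOf H (contactPolytope v)) ≤
      1 / (2 * Real.pi) ^ (((indexJ H v).card : ℤ) - (k : ℤ)) *
        ∏ j ∈ indexJ H v, hFactor (tildeC H (c j) (v j)) (alphaOf H a (c j) (v j)) ∧
    ∀ j ∈ indexJ H v, tildeC H (c j) (v j) ≠ 1 →
      Integrable (hFun (tildeC H (c j) (v j)) (alphaOf H a (c j) (v j))) ∧
      ∀ t : ℝ, hFun (tildeC H (c j) (v j)) (alphaOf H a (c j) (v j)) t =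
        ‖distGaussianHat (alphaOf H a (c j) (v j)) (√(1 - tildeC H (c j) (v j)) * t)‖ ^
          (1 / (1 - tildeC H (c j) (v j))) := by
  have hKL := subset_contactPolytope hsymm hK
  have hα : ∀ j ∈ indexJ H v, alphaOf H a (c j) (v j) = a * √(c j) := fun j hj =>
    alphaOf_eq H (hK.pos j).le ((mem_indexJ H).1 hj)
  have hα0 : ∀ j ∈ indexJ H v, 0 ≤ alphaOf H a (c j) (v j) := fun j hj => by
    rw [hα j hj]
    positivity
  have hne : (sectionOf H (K : Set (EuclideanSpace ℝ (Fin n)))).Nonempty :=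
    ⟨0, hK.ball_subset (by simp)⟩
  have hsub : sectionOf H (K : Set (EuclideanSpace ℝ (Fin n))) ⊆
      sectionOf H (contactPolytope v) := Set.preimage_mono hKL
  refine ⟨hKL, ?_, ?_, fun j hj hj1 => ?_⟩
  · refine willsFunctional_mono (Set.smul_set_mono hsub) (hne.smul_set)
      (Bornology.IsBounded.smul₀ ?_ a)
    obtain ⟨R, hR⟩ := (isBounded_contactPolytope hK).subset_closedBall 0
    refine (Metric.isBounded_closedBall (x := 0) (r := R)).subset fun x hx => ?_
    simpa using hR hx
  · obtain ⟨A, hA⟩ := exists_isometry_indexJ H hK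
    -- The coordinate functionals of `A` as vectors of `H`; their squared norms are the `c̃_j`.
    let u : indexJ H v → H := fun j => √(c j) • ⟨H.starProjection (v j),
      Submodule.starProjection_apply_mem _ _⟩
    have hu : ∀ x j, A x j = ⟪u j, x⟫ := by
      intro x j
      rw [hA, Submodule.coe_inner, Submodule.coe_smul, real_inner_smul_left,
        inner_starProjection_of_mem H x.2]
    have hnorm : ∀ j, ‖u j‖ ^ 2 = tildeC H (c j) (v j) := by
      intro j
      rw [norm_smul, mul_pow, Real.norm_eq_abs, sq_abs, Real.sq_sqrt (hK.pos j).le]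
      rfl
    have hu0 : ∀ j, u j ≠ 0 := by
      intro j h0
      have h1 := hnorm j
      rw [h0, norm_zero] at h1
      have := tildeC_pos H (hK.pos j) ((mem_indexJ H).1 j.2)
      norm_num at h1
      linarith
    have h1 := willsFunctional_le_integral_prod_distGaussian A
      (α := fun j => alphaOf H a (c j) (v j)) (fun j => hα0 j j.2)
      (s := a • sectionOf H (contactPolytope v)) (hne.mono hsub).smul_set (by
        rintro _ ⟨x, hx, rfl⟩ j
        have h2 : |⟪(x : EuclideanSpace ℝ (Fin n)), v j⟫| ≤ 1 := hx j
        rw [real_inner_comm] at h2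
        simp only [map_smul, PiLp.smul_apply, smul_eq_mul]
        rw [hA, hα j j.2, abs_mul, abs_mul, abs_of_pos ha, abs_of_nonneg (Real.sqrt_nonneg _)]
        exact mul_le_mul_of_nonneg_left (mul_le_of_le_one_right (Real.sqrt_nonneg _) h2) ha.le)
    refine h1.trans ((integral_prod_distGaussian_le_prod_hFactor A hu hu0
      fun j => hα0 j j.2).trans_eq ?_)
    rw [Fintype.card_coe, hH]
    simp_rw [hnorm]
    rw [Finset.prod_coe_sort (indexJ H v) fun j =>
      hFactor (tildeC H (c j) (v j)) (alphaOf H a (c j) (v j))]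
  · have hlt := lt_of_le_of_ne (tildeC_le_one H hK j) hj1
    exact ⟨integrable_hFun (tildeC_pos H (hK.pos j) ((mem_indexJ H).1 hj)) hlt (hα0 j hj),
      hFun_eq hlt (hα0 j hj)⟩
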